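/- **Theorem.** There is an absolute constant $C>0$ and, for every $\delta\in(0,1)$, a constant $c(\delta)>0$ depending only on $\delta$, such that the following holds. Let $M,N,K$ be integers with $K\ge 1$, $N>K\sqrt K$ and $$M> C\,K\ln\!\left(\frac{N}{K\,c(\delta)}\right)+K+1 .$$ Let $\Phi\in\mathbb R^{M\times N}$ be a random matrix with columns $\phi_1,\dots,\phi_N$ and let $\phi_d\in\mathbb R^M$ be a further random (dummy, "$0$th") column such that all entries of $\Phi$ and $\phi_d$ are i.i.d. $\mathcal N(0,1/M)$ (so every column has expected squared norm $1$). Let $x\in\mathbb R^N$ be an arbitrary fixed vector with at most $K$ nonzero entries, $y=\Phi x$, and let $\alpha\in\mathbb R$ be arbitrary. Then, with probability exceeding $1-\delta$, the modified Orthogonal Least Squares (OLS) algorithm with input $y,\Phi,K,\phi_d,\alpha$ outputs exactly $\hat x=x$. Here modified OLS is the following algorithm. Put $y_1=y+\alpha\phi_d$ and $T^0=\{d\}$, i.e. the dummy column is preselected. For $k=1,\dots,K$ choose $$h^k\in\operatorname*{arg\,min}_{1\le i\le N}\big\|P^\perp_{T^{k-1}\cup\{i\}}\,y_1\big\|_2^2,\qquad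 T^k=T^{k-1}\cup\{h^k\},$$ where $P_S^\perp$ is the orthogonal projection onto the orthogonal complement of the span of the columns indexed by $S$; ties are broken by an arbitrary fixed rule that selects an element of each nonempty set of minimizers. Let $x^K\in\mathbb R^{\{d,1,\dots,N\}}$ be a least squares solution, minimizing $\|y_1-[\phi_d\ \Phi]u\|_2$ over all $u$ supported in $T^K$; let $\hat T$ minimize $\|x^K-x^K_S\|_2$ over the sets $S\subseteq\{1,\dots,N\}$ with $|S|=K$ (where $x^K_S$ is $x^K$ with the entries outside $S$ set to zero), and output $\hat x\in\mathbb R^N$ with $\hat x_i=x^K_i$ for $i\in\hat T$ and $\hat x_i=0$ otherwise. (On the event of success $x$ is the output for every choice of $x^K$ and $\hat T$.) In particular $M=O(K\ln(N/K))$ measurements suffice: for each $\delta$ there is $B_\delta$ with $C K\ln\!\big(\tfrac{N}{K c(\delta)}\big)+K+1\le B_\delta\,K\ln(N/K)$ for all $K\ge1$ and $N>K\sqrt K$. -/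

import Mathlib

open MeasureTheory ProbabilityTheory

noncomputable section

namespace OLS

/-- The `i`-th column of `A`, as a vector of Euclidean space. -/
def colVec {M : ℕ} {ι : Type*} (A : Matrix (Fin M) ι ℝ) (i : ι) : EuclideanSpace ℝ (Fin M) :=
  WithLp.toLp 2 (fun m => A m i)

/-- The orthogonal projection of `v` on the orthogonal complement of the span of the columns of `A`
with index in `S`. -/
def dualProj {M : ℕ} {ι : Type*} (A : Matrix (Fin M) ι ℝ) (S : Finset ι)
    (v : EuclideanSpace ℝ (Fin M)) : EuclideanSpace ℝ (Fin M) :=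
  (Submodule.span ℝ (colVec A '' (S : Set ι)))ᗮ.starProjection v

/-- The set of minimizers `i ∈ H` of `‖P^⊥_{T ∪ {i}} y‖²`. -/
def candidates {M : ℕ} {ι : Type*} [DecidableEq ι] (A : Matrix (Fin M) ι ℝ) (H : Finset ι)
    (y : EuclideanSpace ℝ (Fin M)) (T : Finset ι) : Finset ι := by
  classical
  exact H.filter fun i =>
    ∀ j ∈ H, ‖dualProj A (insert i T) y‖ ^ 2 ≤ ‖dualProj A (insert j T) y‖ ^ 2

/-- The support set after `k` iterations of OLS, started at `T₀`; each iteration adds one minimizer,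
the one that the tie-breaking rule `τ` picks from the set of all minimizers. -/
def support {M : ℕ} {ι : Type*} [DecidableEq ι] (τ : Finset ι → ι) (A : Matrix (Fin M) ι ℝ)
    (H : Finset ι) (y : EuclideanSpace ℝ (Fin M)) (T₀ : Finset ι) : ℕ → Finset ι
  | 0 => T₀
  | k + 1 => insert (τ (candidates A H y (support τ A H y T₀ k))) (support τ A H y T₀ k)

/-- `u` is a least squares solution of `A u ≈ y` among the vectors supported in `T`. -/
def IsLeastSquares {M : ℕ} {ι : Type*} [Fintype ι] (A : Matrix (Fin M) ι ℝ)
    (y : EuclideanSpace ℝ (Fin M)) (T : Finset ι) (u : ι → ℝ) : Prop :=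
  (∀ i, i ∉ T → u i = 0) ∧
    ∀ v : ι → ℝ, (∀ i, i ∉ T → v i = 0) →
      ‖y - WithLp.toLp 2 (A.mulVec u)‖ ≤ ‖y - WithLp.toLp 2 (A.mulVec v)‖

/-- The restriction `u_S` of the vector `u` to the index set `S`, extended by zero. -/
def restrict {ι : Type*} (S : Finset ι) (u : ι → ℝ) : ι → ℝ :=
  Set.indicator (S : Set ι) u

/-- `That` is a set of `K` indices in `H` with the least `‖u - u_S‖₂` among all such sets `S`. -/
def IsBestSupport {ι : Type*} [Fintype ι] (H : Finset ι) (K : ℕ) (u : ι → ℝ)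
    (That : Finset ι) : Prop :=
  That ⊆ H ∧ That.card = K ∧
    ∀ S : Finset ι, S ⊆ H → S.card = K →
      ‖(WithLp.toLp 2 (u - restrict That u) : EuclideanSpace ℝ ι)‖ ≤
        ‖(WithLp.toLp 2 (u - restrict S u) : EuclideanSpace ℝ ι)‖

/-- `xhat` is an output of OLS, run for `K` iterations on the measurement vector `y` with the
dictionary `A`, candidate indices `H`, preselected indices `T₀` and tie-breaking rule `τ`.
Plain OLS is `H = univ`, `T₀ = ∅`. -/
def IsOutput {M : ℕ} {ι : Type*} [Fintype ι] [DecidableEq ι] (τ : Finset ι → ι)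
    (A : Matrix (Fin M) ι ℝ) (H T₀ : Finset ι) (K : ℕ) (y : EuclideanSpace ℝ (Fin M))
    (xhat : ι → ℝ) : Prop :=
  ∃ u : ι → ℝ, IsLeastSquares A y (support τ A H y T₀ K) u ∧
    ∃ That : Finset ι, IsBestSupport H K u That ∧ xhat = restrict That u

/-- The matrix `Φ` with the dummy column `d` adjoined; the dummy column has index `none`. -/
def augment {M N : ℕ} (Φ : Matrix (Fin M) (Fin N) ℝ) (d : Fin M → ℝ) :
    Matrix (Fin M) (Option (Fin N)) ℝ :=
  Matrix.of fun m j => j.elim (d m) (fun i => Φ m i)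

/-- Modified OLS: from the measurement vector `y` form `y + α d`, preselect the dummy column `d`,
then run `K` iterations of OLS that choose among the columns of `Φ`. `IsModifiedOutput` says that
`xhat` is the part of the output that belongs to the columns of `Φ`. -/
def IsModifiedOutput {M N : ℕ} (τ : Finset (Option (Fin N)) → Option (Fin N))
    (Φ : Matrix (Fin M) (Fin N) ℝ) (d : Fin M → ℝ) (α : ℝ) (K : ℕ) (y : Fin M → ℝ)
    (xhat : Fin N → ℝ) : Prop :=
  ∃ z : Option (Fin N) → ℝ,
    IsOutput τ (augment Φ d) (Finset.univ.map Function.Embedding.some) {none} K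
      (WithLp.toLp 2 (y + α • d)) z ∧
    xhat = fun i => z (some i)

end OLS

end

/-! Let `S` consist of the dummy index and the support of `x`, so that `y₁` lies in the span of the
columns in `S`, and let `r` be the residual after selecting `T ⊆ S`. With `ψ_i` the part of column
`i` orthogonal to the selected span, adding `i` lowers the squared residual norm by `⟪ψ_i, r⟫² /
‖ψ_i‖²`. Suppose that the columns in `S`, together with any one further column, have squared
smallest singular value at least `c`, and that all squared column norms are at most `L`.
Cauchy-Schwarz then yields a right column whose gain exceeds `β ‖r‖²` whenever `K L β < c`
(`exists_lt_inner_sq`), while a wrong column with `⟪φ_i, r⟫² ≤ β c ‖r‖²` gains at most `β ‖r‖²`.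
Hence a right column is selected (`candidates_subset_sdiff`).

The residuals of the actual run depend on all columns. They are therefore compared with an oracle
run allowed to choose only right columns: its residuals are functions of the columns in `S`, hence
independent of every wrong column, and a Gaussian tail bound applies to each correlation. If all
these correlations are small, the two runs agree until all of `S` is found (`subset_support`).

The singular value bound comes from chi-squared tails on an integer grid with at most `(8n+1)^n`
points, where `n ≤ K + 2`. This crude count costs a factor `log K` in the exponent, which is
harmless: `N > K√K` makes `K` and `N` at most powers of `N / K` (`failure_bound_le`). -/

namespace OLS

/-! ### Residuals and the effect of adding one column. -/

section Projection

variable {M : ℕ} {ι : Type*} (A : Matrix (Fin M) ι ℝ)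

lemma exists_dualProj_eq_sub (T : Finset ι) (v : EuclideanSpace ℝ (Fin M)) :
    ∃ u ∈ Submodule.span ℝ (colVec A '' (T : Set ι)), dualProj A T v = v - u := by
  refine ⟨(Submodule.span ℝ (colVec A '' (T : Set ι))).starProjection v,
    Submodule.starProjection_apply_mem _ _, ?_⟩
  rw [dualProj, Submodule.starProjection_orthogonal_val]

lemma dualProj_mem (T : Finset ι) (v : EuclideanSpace ℝ (Fin M)) :
    dualProj A T v ∈ (Submodule.span ℝ (colVec A '' (T : Set ι)))ᗮ :=
  Submodule.starProjection_apply_mem _ _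

lemma dualProj_eq_zero {T : Finset ι} {u : EuclideanSpace ℝ (Fin M)}
    (hu : u ∈ Submodule.span ℝ (colVec A '' (T : Set ι))) : dualProj A T u = 0 := by
  rw [dualProj, Submodule.starProjection_orthogonal_val,
    Submodule.starProjection_eq_self_iff.2 hu, sub_self]

lemma dualProj_eq_self {T : Finset ι} {u : EuclideanSpace ℝ (Fin M)}
    (hu : u ∈ (Submodule.span ℝ (colVec A '' (T : Set ι)))ᗮ) : dualProj A T u = u :=
  Submodule.starProjection_eq_self_iff.2 hu

lemma dualProj_sub (T : Finset ι) (u v : EuclideanSpace ℝ (Fin M)) :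
    dualProj A T (u - v) = dualProj A T u - dualProj A T v :=
  map_sub _ u v

lemma dualProj_add (T : Finset ι) (u v : EuclideanSpace ℝ (Fin M)) :
    dualProj A T (u + v) = dualProj A T u + dualProj A T v :=
  map_add _ u v

lemma dualProj_smul (T : Finset ι) (c : ℝ) (v : EuclideanSpace ℝ (Fin M)) :
    dualProj A T (c • v) = c • dualProj A T v := by
  simp [dualProj]

lemma norm_dualProj_le (T : Finset ι) (v : EuclideanSpace ℝ (Fin M)) : ‖dualProj A T v‖ ≤ ‖v‖ :=
  Submodule.norm_starProjection_apply_le _ _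

lemma norm_dualProj_le_norm_sub {T : Finset ι} (v : EuclideanSpace ℝ (Fin M))
    {u : EuclideanSpace ℝ (Fin M)} (hu : u ∈ Submodule.span ℝ (colVec A '' (T : Set ι))) :
    ‖dualProj A T v‖ ≤ ‖v - u‖ := by
  have h : dualProj A T v = dualProj A T (v - u) := by
    rw [dualProj_sub, dualProj_eq_zero A hu, sub_zero]
  rw [h]
  exact norm_dualProj_le A T _

lemma inner_dualProj_left (T : Finset ι) (u v : EuclideanSpace ℝ (Fin M)) :
    inner ℝ (dualProj A T u) v = inner ℝ u (dualProj A T v) :=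
  Submodule.inner_starProjection_left_eq_right _ _ _

lemma dualProj_dualProj (T : Finset ι) (v : EuclideanSpace ℝ (Fin M)) :
    dualProj A T (dualProj A T v) = dualProj A T v :=
  dualProj_eq_self A (dualProj_mem A T v)

lemma inner_dualProj_dualProj (T : Finset ι) (u v : EuclideanSpace ℝ (Fin M)) :
    inner ℝ (dualProj A T u) (dualProj A T v) = inner ℝ u (dualProj A T v) := by
  rw [inner_dualProj_left, dualProj_dualProj]

variable [DecidableEq ι]

lemma exists_dualProj_insert_eq (T : Finset ι) (i : ι) (y : EuclideanSpace ℝ (Fin M)) :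
    ∃ c : ℝ, dualProj A (insert i T) y = dualProj A T y - c • dualProj A T (colVec A i) := by
  obtain ⟨u, hu, h⟩ := exists_dualProj_eq_sub A (insert i T) y
  rw [Finset.coe_insert, Set.image_insert_eq, Submodule.mem_span_insert] at hu
  obtain ⟨c, z, hz, rfl⟩ := hu
  refine ⟨c, ?_⟩
  have h1 : dualProj A T (dualProj A (insert i T) y) = dualProj A (insert i T) y := by
    refine dualProj_eq_self A (Submodule.orthogonal_le (Submodule.span_mono ?_)
      (dualProj_mem A (insert i T) y))
    rw [Finset.coe_insert]
    exact Set.image_mono (Set.subset_insert _ _)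
  rw [← h1, h, dualProj_sub, dualProj_add, dualProj_smul, dualProj_eq_zero A hz, add_zero]

lemma norm_dualProj_insert_le (T : Finset ι) (i : ι) (y : EuclideanSpace ℝ (Fin M)) (c : ℝ) :
    ‖dualProj A (insert i T) y‖ ≤ ‖dualProj A T y - c • dualProj A T (colVec A i)‖ := by
  obtain ⟨u, hu, h⟩ := exists_dualProj_eq_sub A T y
  obtain ⟨z, hz, h'⟩ := exists_dualProj_eq_sub A T (colVec A i)
  have hle : Submodule.span ℝ (colVec A '' (T : Set ι)) ≤
      Submodule.span ℝ (colVec A '' ((insert i T : Finset ι) : Set ι)) := by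
    rw [Finset.coe_insert]
    exact Submodule.span_mono (Set.image_mono (Set.subset_insert _ _))
  have hi : colVec A i ∈ Submodule.span ℝ (colVec A '' ((insert i T : Finset ι) : Set ι)) :=
    Submodule.subset_span ⟨i, by simp, rfl⟩
  have := norm_dualProj_le_norm_sub A (T := insert i T) y
    (u := u + c • (colVec A i - z))
    (Submodule.add_mem _ (hle hu) (Submodule.smul_mem _ _ (Submodule.sub_mem _ hi (hle hz))))
  rw [h, h']
  rwa [← sub_sub] at this

/-- Take the optimal coefficient `⟪ψ, r⟫ / ‖ψ‖²` in the preceding bound. Together with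
`le_norm_sq_dualProj_insert` this is the exact gain formula of OLS. -/
lemma norm_sq_dualProj_insert_le {T : Finset ι} {i : ι} {y : EuclideanSpace ℝ (Fin M)}
    (hi : dualProj A T (colVec A i) ≠ 0) :
    ‖dualProj A (insert i T) y‖ ^ 2 ≤ ‖dualProj A T y‖ ^ 2 -
      inner ℝ (dualProj A T (colVec A i)) (dualProj A T y) ^ 2 /
        ‖dualProj A T (colVec A i)‖ ^ 2 := by
  set ψ := dualProj A T (colVec A i)
  set r := dualProj A T y
  have hψ : (0 : ℝ) < ‖ψ‖ ^ 2 := by positivity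
  calc ‖dualProj A (insert i T) y‖ ^ 2
      ≤ ‖r - (inner ℝ ψ r / ‖ψ‖ ^ 2) • ψ‖ ^ 2 := by
        gcongr
        exact norm_dualProj_insert_le A T i y _
    _ = _ := by
        rw [norm_sub_sq_real, inner_smul_right, norm_smul, mul_pow, Real.norm_eq_abs, sq_abs,
          real_inner_comm]
        field_simp
        ring

lemma le_norm_sq_dualProj_insert {T : Finset ι} {i : ι} {y : EuclideanSpace ℝ (Fin M)}
    (hi : dualProj A T (colVec A i) ≠ 0) :
    ‖dualProj A T y‖ ^ 2 - inner ℝ (dualProj A T (colVec A i)) (dualProj A T y) ^ 2 /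
        ‖dualProj A T (colVec A i)‖ ^ 2 ≤ ‖dualProj A (insert i T) y‖ ^ 2 := by
  obtain ⟨c, hc⟩ := exists_dualProj_insert_eq A T i y
  rw [hc]
  set ψ := dualProj A T (colVec A i)
  set r := dualProj A T y
  have hψ : (0 : ℝ) < ‖ψ‖ ^ 2 := by positivity
  rw [norm_sub_sq_real, inner_smul_right, norm_smul, mul_pow, Real.norm_eq_abs, sq_abs,
    real_inner_comm ψ r, sub_le_iff_le_add]
  -- Completing the square: no coefficient `c` does better than the optimal one.
  have h : 0 ≤ (inner ℝ ψ r - c * ‖ψ‖ ^ 2) ^ 2 / ‖ψ‖ ^ 2 := by positivity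
  have h2 : (inner ℝ ψ r - c * ‖ψ‖ ^ 2) ^ 2 / ‖ψ‖ ^ 2 =
      inner ℝ ψ r ^ 2 / ‖ψ‖ ^ 2 - 2 * (c * inner ℝ ψ r) + c ^ 2 * ‖ψ‖ ^ 2 := by
    field_simp
    ring
  linarith

end Projection

/-! ### Linear combinations of columns and lower singular value bounds. -/

section Synthesis

variable {M : ℕ} {ι : Type*} [Fintype ι] (A : Matrix (Fin M) ι ℝ)

/-- The linear combination of the columns of `A` with coefficients `w`. -/
noncomputable def synth (w : ι → ℝ) : EuclideanSpace ℝ (Fin M) := WithLp.toLp 2 (A.mulVec w)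

lemma synth_eq_sum (w : ι → ℝ) : synth A w = ∑ j, w j • colVec A j := by
  ext m
  simp [synth, colVec, Matrix.mulVec, dotProduct, mul_comm]

lemma synth_sub (u w : ι → ℝ) : synth A (u - w) = synth A u - synth A w := by
  simp [synth, Matrix.mulVec_sub]

lemma synth_mem_span {T : Finset ι} {w : ι → ℝ} (hw : ∀ j, j ∉ T → w j = 0) :
    synth A w ∈ Submodule.span ℝ (colVec A '' (T : Set ι)) := by
  rw [synth_eq_sum]
  refine Submodule.sum_mem _ fun j _ => ?_
  by_cases hj : j ∈ T
  · exact Submodule.smul_mem _ _ (Submodule.subset_span ⟨j, hj, rfl⟩)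
  · simp [hw j hj]

lemma exists_synth_of_mem_span {T : Finset ι} {u : EuclideanSpace ℝ (Fin M)}
    (hu : u ∈ Submodule.span ℝ (colVec A '' (T : Set ι))) :
    ∃ t : ι → ℝ, (∀ j, j ∉ T → t j = 0) ∧ synth A t = u := by
  classical
  induction hu using Submodule.span_induction with
  | mem x hx =>
    obtain ⟨j, hj, rfl⟩ := hx
    refine ⟨Pi.single j 1, fun k hk => ?_, ?_⟩
    · rw [Pi.single_eq_of_ne]
      rintro rfl
      exact hk hj
    · rw [synth_eq_sum, Finset.sum_eq_single j] <;> simp +contextual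
  | zero => exact ⟨0, by simp, by simp [synth]⟩
  | add x y _ _ hx hy =>
    obtain ⟨s, hs, rfl⟩ := hx
    obtain ⟨t, ht, rfl⟩ := hy
    exact ⟨s + t, fun j hj => by simp [hs j hj, ht j hj], by simp [synth, Matrix.mulVec_add]⟩
  | smul c x _ hx =>
    obtain ⟨s, hs, rfl⟩ := hx
    exact ⟨c • s, fun j hj => by simp [hs j hj], by simp [synth, Matrix.mulVec_smul]⟩

/-- The columns of `A` with index in `U` have squared smallest singular value at least `c`. -/
def LowerBounded (c : ℝ) (U : Finset ι) : Prop :=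
  ∀ v : ι → ℝ, (∀ j, j ∉ U → v j = 0) → c * ∑ j, v j ^ 2 ≤ ‖synth A v‖ ^ 2

variable {A}

lemma LowerBounded.mono {c : ℝ} {U V : Finset ι} (h : LowerBounded A c V) (hUV : U ⊆ V) :
    LowerBounded A c U :=
  fun v hv => h v fun j hj => hv j fun hj' => hj (hUV hj')

lemma LowerBounded.eq_of_synth_eq {c : ℝ} {U : Finset ι} (h : LowerBounded A c U) (hc : 0 < c)
    {u w : ι → ℝ} (hu : ∀ j, j ∉ U → u j = 0) (hw : ∀ j, j ∉ U → w j = 0)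
    (huw : synth A u = synth A w) : u = w := by
  have h1 := h (u - w) fun j hj => by simp [hu j hj, hw j hj]
  rw [synth_sub, huw, sub_self, norm_zero] at h1
  have h2 : ∑ j, (u - w) j ^ 2 = 0 :=
    le_antisymm (by nlinarith) (Finset.sum_nonneg fun j _ => sq_nonneg _)
  rw [Finset.sum_eq_zero_iff_of_nonneg fun j _ => sq_nonneg _] at h2
  funext j
  have := h2 j (Finset.mem_univ j)
  simpa [sub_eq_zero] using this

/-- The residual is itself a combination of columns, with coefficients `w - t` where `t` is
supported in `T`; outside `T` these are the coefficients of `w`. -/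
lemma LowerBounded.le_norm_dualProj_synth [DecidableEq ι] {c : ℝ} {U T : Finset ι}
    (h : LowerBounded A c U) (hc : 0 ≤ c) (hT : T ⊆ U) {w : ι → ℝ} (hw : ∀ j, j ∉ U → w j = 0) :
    c * ∑ j with j ∉ T, w j ^ 2 ≤ ‖dualProj A T (synth A w)‖ ^ 2 := by
  obtain ⟨u, hu, hr⟩ := exists_dualProj_eq_sub A T (synth A w)
  obtain ⟨t, ht, rfl⟩ := exists_synth_of_mem_span A hu
  rw [hr, ← synth_sub]
  refine le_trans ?_ (h (w - t) fun j hj => ?_)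
  · refine mul_le_mul_of_nonneg_left ?_ hc
    calc ∑ j with j ∉ T, w j ^ 2 = ∑ j with j ∉ T, (w - t) j ^ 2 := by
          refine Finset.sum_congr rfl fun j hj => ?_
          rw [Pi.sub_apply, ht j (Finset.mem_filter.1 hj).2, sub_zero]
      _ ≤ _ := Finset.sum_le_sum_of_subset_of_nonneg (Finset.filter_subset _ _)
          fun j _ _ => sq_nonneg _
  · rw [Pi.sub_apply, hw j hj, ht j fun hj' => hj (hT hj'), sub_zero]

lemma synth_single [DecidableEq ι] (i : ι) : synth A (Pi.single i 1) = colVec A i := by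
  rw [synth_eq_sum, Finset.sum_eq_single i] <;> simp +contextual

lemma LowerBounded.le_norm_dualProj_colVec [DecidableEq ι] {c : ℝ} {U T : Finset ι}
    (h : LowerBounded A c U) (hc : 0 ≤ c) (hT : T ⊆ U) {i : ι} (hi : i ∈ U) (hiT : i ∉ T) :
    c ≤ ‖dualProj A T (colVec A i)‖ ^ 2 := by
  have h1 := h.le_norm_dualProj_synth hc hT (w := Pi.single i 1) fun j hj => by
    rw [Pi.single_eq_of_ne]
    rintro rfl
    exact hj hi
  rw [synth_single] at h1
  refine le_trans ?_ h1
  rw [Finset.sum_eq_single i] <;> simp +contextual [hiT]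

end Synthesis

/-! ### Deterministic analysis of the greedy selection. -/

section Greedy

variable {M : ℕ} {ι : Type*} [Fintype ι] [DecidableEq ι] {A : Matrix (Fin M) ι ℝ}

/-- Write `‖r‖² = ∑ w_j ⟪ψ_j, r⟫` over `S \ T` and apply Cauchy-Schwarz. The singular value bound
gives `∑ w_j² ≤ ‖r‖² / c`, so if every right column failed, then `c ‖r‖⁴ ≤ K L β ‖r‖⁴`, against `K L
β < c`. -/
lemma exists_lt_inner_sq {S T : Finset ι} {c L K β : ℝ} (h : LowerBounded A c S) (hc : 0 < c)
    (hTS : T ⊆ S) (hL : ∀ j ∈ S, ‖colVec A j‖ ^ 2 ≤ L) (hL0 : 0 ≤ L) (hβ : 0 ≤ β)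
    (hK : ((S \ T).card : ℝ) ≤ K) (hKβ : K * L * β < c) {w : ι → ℝ} (hw : ∀ j, j ∉ S → w j = 0)
    (hr : dualProj A T (synth A w) ≠ 0) :
    ∃ j ∈ S \ T, β * ‖dualProj A T (colVec A j)‖ ^ 2 * ‖dualProj A T (synth A w)‖ ^ 2 <
      inner ℝ (dualProj A T (colVec A j)) (dualProj A T (synth A w)) ^ 2 := by
  by_contra! hcon
  set r := dualProj A T (synth A w) with hrdef
  have hsum : ‖r‖ ^ 2 = ∑ j ∈ S \ T, w j * inner ℝ (dualProj A T (colVec A j)) r := by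
    have h1 : r = ∑ j ∈ S \ T, w j • dualProj A T (colVec A j) := by
      have h2 : r = ∑ j, w j • dualProj A T (colVec A j) := by
        rw [hrdef, synth_eq_sum]
        simp only [dualProj, map_sum, map_smul]
      rw [h2]
      refine (Finset.sum_subset (Finset.subset_univ _) fun j _ hj => ?_).symm
      by_cases hjS : j ∈ S
      · have hjT : j ∈ T := by
          by_contra hjT
          exact hj (Finset.mem_sdiff.2 ⟨hjS, hjT⟩)
        rw [dualProj_eq_zero A (Submodule.subset_span ⟨j, hjT, rfl⟩), smul_zero]
      · rw [hw j hjS, zero_smul]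
    rw [← real_inner_self_eq_norm_sq]
    nth_rw 1 [h1]
    rw [sum_inner]
    simp only [real_inner_smul_left]
  have hlow : c * ∑ j ∈ S \ T, w j ^ 2 ≤ ‖r‖ ^ 2 := by
    refine le_trans (mul_le_mul_of_nonneg_left ?_ hc.le) (h.le_norm_dualProj_synth hc.le hTS hw)
    refine Finset.sum_le_sum_of_subset_of_nonneg (fun j hj => ?_) fun j _ _ => sq_nonneg _
    simpa using (Finset.mem_sdiff.1 hj).2
  have hup : ∑ j ∈ S \ T, inner ℝ (dualProj A T (colVec A j)) r ^ 2 ≤ K * L * β * ‖r‖ ^ 2 := by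
    calc ∑ j ∈ S \ T, inner ℝ (dualProj A T (colVec A j)) r ^ 2
        ≤ ∑ j ∈ S \ T, β * L * ‖r‖ ^ 2 := by
          refine Finset.sum_le_sum fun j hj => (hcon j hj).trans ?_
          gcongr
          refine le_trans ?_ (hL j (Finset.mem_sdiff.1 hj).1)
          gcongr
          exact norm_dualProj_le A T _
      _ = ((S \ T).card : ℝ) * (β * L * ‖r‖ ^ 2) := by rw [Finset.sum_const, nsmul_eq_mul]
      _ ≤ K * (β * L * ‖r‖ ^ 2) := by gcongr
      _ = _ := by ring
  have hCS := Finset.sum_mul_sq_le_sq_mul_sq (S \ T) w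
    fun j => inner ℝ (dualProj A T (colVec A j)) r
  rw [← hsum] at hCS
  have hrpos : 0 < ‖r‖ ^ 2 := by positivity
  have h0 : 0 ≤ ∑ j ∈ S \ T, w j ^ 2 := Finset.sum_nonneg fun j _ => sq_nonneg _
  have h3 : c * (‖r‖ ^ 2) ^ 2 ≤ ‖r‖ ^ 2 * (K * L * β * ‖r‖ ^ 2) :=
    calc c * (‖r‖ ^ 2) ^ 2 ≤ c * ((∑ j ∈ S \ T, w j ^ 2) *
          ∑ j ∈ S \ T, inner ℝ (dualProj A T (colVec A j)) r ^ 2) := by gcongr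
      _ = (c * ∑ j ∈ S \ T, w j ^ 2) *
          ∑ j ∈ S \ T, inner ℝ (dualProj A T (colVec A j)) r ^ 2 := by ring
      _ ≤ _ := by gcongr
  nlinarith [mul_pos hrpos hrpos]

omit [Fintype ι] in
lemma mem_candidates {H T : Finset ι} {y : EuclideanSpace ℝ (Fin M)} {i : ι} :
    i ∈ candidates A H y T ↔ i ∈ H ∧
      ∀ j ∈ H, ‖dualProj A (insert i T) y‖ ^ 2 ≤ ‖dualProj A (insert j T) y‖ ^ 2 := by
  simp [candidates]

omit [Fintype ι] in
lemma candidates_nonempty {H : Finset ι} (hH : H.Nonempty) (y : EuclideanSpace ℝ (Fin M))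
    (T : Finset ι) : (candidates A H y T).Nonempty := by
  obtain ⟨i, hi, hmin⟩ := H.exists_min_image (fun i => ‖dualProj A (insert i T) y‖ ^ 2) hH
  exact ⟨i, mem_candidates.2 ⟨hi, hmin⟩⟩

omit [Fintype ι] in
-- The tie-breaking rule sees the whole set of minimizers, so comparing with the oracle run needs
-- equality of these sets, not merely a common minimizer.
lemma candidates_eq_of_subset {H H' T : Finset ι} {y : EuclideanSpace ℝ (Fin M)} (hH : H' ⊆ H)
    (hsub : candidates A H y T ⊆ H') : candidates A H y T = candidates A H' y T := by
  ext i
  constructor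
  · intro hi
    exact mem_candidates.2 ⟨hsub hi, fun j hj => (mem_candidates.1 hi).2 j (hH hj)⟩
  · intro hi
    obtain ⟨hi, hmin⟩ := mem_candidates.1 hi
    obtain ⟨j, hj⟩ := candidates_nonempty (A := A) ⟨i, hH hi⟩ y T
    exact mem_candidates.2 ⟨hH hi, fun l hl => (hmin j (hsub hj)).trans
      ((mem_candidates.1 hj).2 l hl)⟩

lemma candidates_subset_sdiff {H S T : Finset ι} {c L K β : ℝ} (hc : 0 < c)
    (hlow : ∀ i ∈ H, LowerBounded A c (insert i S)) (hTS : T ⊆ S) (hST : S \ T ⊆ H)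
    (hne : (S \ T).Nonempty) (hL : ∀ j ∈ S, ‖colVec A j‖ ^ 2 ≤ L) (hL0 : 0 ≤ L) (hβ : 0 ≤ β)
    (hK : ((S \ T).card : ℝ) ≤ K) (hKβ : K * L * β < c) {w : ι → ℝ} (hw : ∀ j, j ∉ S → w j = 0)
    (hw' : ∀ j ∈ S \ T, w j ≠ 0)
    (hwrong : ∀ i ∈ H, i ∉ S → inner ℝ (colVec A i) (dualProj A T (synth A w)) ^ 2 ≤
      β * c * ‖dualProj A T (synth A w)‖ ^ 2) :
    candidates A H (synth A w) T ⊆ S \ T := by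
  obtain ⟨j₀, hj₀⟩ := hne
  have hS : LowerBounded A c S := (hlow j₀ (hST hj₀)).mono (Finset.subset_insert _ _)
  have hr : dualProj A T (synth A w) ≠ 0 := by
    intro h0
    have h1 := hS.le_norm_dualProj_synth hc.le hTS hw
    rw [h0, norm_zero] at h1
    have h2 : w j₀ ^ 2 ≤ ∑ j with j ∉ T, w j ^ 2 :=
      Finset.single_le_sum (f := fun j => w j ^ 2) (fun j _ => sq_nonneg _)
        (by simpa using (Finset.mem_sdiff.1 hj₀).2)
    have h3 : 0 < w j₀ ^ 2 := by
      have := hw' j₀ hj₀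
      positivity
    nlinarith
  obtain ⟨j, hj, hlt⟩ := exists_lt_inner_sq hS hc hTS hL hL0 hβ hK hKβ hw hr
  have hψ : ∀ i ∈ H, i ∉ T → c ≤ ‖dualProj A T (colVec A i)‖ ^ 2 := fun i hi hiT =>
    (hlow i hi).le_norm_dualProj_colVec hc.le (hTS.trans (Finset.subset_insert _ _))
      (Finset.mem_insert_self _ _) hiT
  have hψ0 : ∀ i ∈ H, i ∉ T → dualProj A T (colVec A i) ≠ 0 := fun i hi hiT h0 => by
    have := hψ i hi hiT
    rw [h0, norm_zero] at this
    linarith [zero_pow (M₀ := ℝ) two_ne_zero]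
  have hjH := hST hj
  have hjT := (Finset.mem_sdiff.1 hj).2
  have hgood : ‖dualProj A (insert j T) (synth A w)‖ ^ 2 <
      (1 - β) * ‖dualProj A T (synth A w)‖ ^ 2 := by
    refine lt_of_le_of_lt (norm_sq_dualProj_insert_le A (hψ0 j hjH hjT)) ?_
    have hpos : 0 < ‖dualProj A T (colVec A j)‖ ^ 2 := hc.trans_le (hψ j hjH hjT)
    have : β * ‖dualProj A T (synth A w)‖ ^ 2 <
        inner ℝ (dualProj A T (colVec A j)) (dualProj A T (synth A w)) ^ 2 /
          ‖dualProj A T (colVec A j)‖ ^ 2 := by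
      rw [lt_div_iff₀ hpos]
      linarith
    linarith
  intro i hi
  obtain ⟨hiH, hmin⟩ := mem_candidates.1 hi
  have hij := lt_of_le_of_lt (hmin j hjH) hgood
  -- Reselecting an index leaves the residual unchanged, whereas the minimum is strictly smaller.
  have hiT : i ∉ T := by
    intro hiT
    rw [Finset.insert_eq_of_mem hiT] at hij
    nlinarith [sq_nonneg ‖dualProj A T (synth A w)‖]
  refine Finset.mem_sdiff.2 ⟨?_, hiT⟩
  by_contra hiS
  have h1 := le_norm_sq_dualProj_insert A (y := synth A w) (hψ0 i hiH hiT)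
  have h2 : inner ℝ (dualProj A T (colVec A i)) (dualProj A T (synth A w)) ^ 2 /
      ‖dualProj A T (colVec A i)‖ ^ 2 ≤ β * ‖dualProj A T (synth A w)‖ ^ 2 := by
    rw [div_le_iff₀ (hc.trans_le (hψ i hiH hiT)), inner_dualProj_dualProj]
    refine (hwrong i hiH hiS).trans ?_
    have := hψ i hiH hiT
    calc β * c * ‖dualProj A T (synth A w)‖ ^ 2
        ≤ β * ‖dualProj A T (colVec A i)‖ ^ 2 * ‖dualProj A T (synth A w)‖ ^ 2 := by gcongr
      _ = _ := by ring
  linarith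

omit [Fintype ι] in
lemma candidates_eq_of_dualProj_eq_zero {H T : Finset ι} {y : EuclideanSpace ℝ (Fin M)}
    (hy : y ∈ Submodule.span ℝ (colVec A '' (T : Set ι))) : candidates A H y T = H := by
  have h0 : ∀ i, dualProj A (insert i T) y = 0 := fun i => by
    refine dualProj_eq_zero A (Submodule.span_mono ?_ hy)
    rw [Finset.coe_insert]
    exact Set.image_mono (Set.subset_insert _ _)
  ext i
  simp [mem_candidates, h0]

/-- If the wrong columns have small correlation with the residuals of the run of OLS that may only
choose among the right columns `H'`, then unrestricted OLS finds all the right columns. -/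
lemma subset_support {H H' S T₀ : Finset ι} {τ : Finset ι → ι}
    (hτ : ∀ s : Finset ι, s.Nonempty → τ s ∈ s) {c L β : ℝ} {K : ℕ} (hc : 0 < c)
    (hlow : ∀ i ∈ H, LowerBounded A c (insert i S)) (hT₀ : T₀ ⊆ S) (hH' : H' ⊆ H)
    (hSH : S \ T₀ ⊆ H') (hcard : S.card ≤ K + T₀.card) (hL : ∀ j ∈ S, ‖colVec A j‖ ^ 2 ≤ L)
    (hL0 : 0 ≤ L) (hβ : 0 ≤ β) (hKβ : K * L * β < c) {w : ι → ℝ} (hw : ∀ j, j ∉ S → w j = 0)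
    (hw' : ∀ j ∈ S \ T₀, w j ≠ 0)
    (hwrong : ∀ k < K, ∀ i ∈ H, i ∉ S →
      inner ℝ (colVec A i) (dualProj A (support τ A H' (synth A w) T₀ k) (synth A w)) ^ 2 ≤
        β * c * ‖dualProj A (support τ A H' (synth A w) T₀ k) (synth A w)‖ ^ 2) :
    S ⊆ support τ A H (synth A w) T₀ K ∧
      support τ A H (synth A w) T₀ K ⊆ insert (τ H) S := by
  -- Invariant: either the run still agrees with the oracle run and has gained a new right index at
  -- each iteration, or all of `S` has been found.
  have key : ∀ k ≤ K, (support τ A H (synth A w) T₀ k = support τ A H' (synth A w) T₀ k ∧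
      T₀ ⊆ support τ A H (synth A w) T₀ k ∧ support τ A H (synth A w) T₀ k ⊆ S ∧
      k + T₀.card ≤ (support τ A H (synth A w) T₀ k).card) ∨
      (S ⊆ support τ A H (synth A w) T₀ k ∧
        support τ A H (synth A w) T₀ k ⊆ insert (τ H) S) := by
    intro k
    induction k with
    | zero => exact fun _ => Or.inl ⟨rfl, subset_rfl, hT₀, by simp [support]⟩
    | succ k ih =>
      intro hk
      by_cases hS : S ⊆ support τ A H (synth A w) T₀ k
      · right
        have hsub : support τ A H (synth A w) T₀ k ⊆ insert (τ H) S := by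
          rcases ih (by omega) with h | h
          · exact h.2.2.1.trans (Finset.subset_insert _ _)
          · exact h.2
        -- The residual is now zero and all of `H` ties. The rule is always handed the same set, so
        -- the only superfluous index that can enter is `τ H`.
        have hcand : candidates A H (synth A w) (support τ A H (synth A w) T₀ k) = H :=
          candidates_eq_of_dualProj_eq_zero
            (synth_mem_span A fun j hj => hw j fun hj' => hj (hS hj'))
        rw [support, hcand]
        exact ⟨hS.trans (Finset.subset_insert _ _),
          Finset.insert_subset (Finset.mem_insert_self _ _) hsub⟩
      · rcases ih (by omega) with ⟨heq, h0, h1, h2⟩ | h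
        · left
          set T := support τ A H (synth A w) T₀ k with hT
          have hne : (S \ T).Nonempty := Finset.sdiff_nonempty.2 hS
          have hsd : S \ T ⊆ S \ T₀ := Finset.sdiff_subset_sdiff subset_rfl h0
          have hKc : ((S \ T).card : ℝ) ≤ K := by
            have := Finset.card_sdiff_add_card_eq_card h1
            exact_mod_cast (by omega : (S \ T).card ≤ K)
          have hcand : candidates A H (synth A w) T ⊆ S \ T :=
            candidates_subset_sdiff hc hlow h1 (hsd.trans (hSH.trans hH')) hne hL hL0 hβ hKc hKβ
              hw (fun j hj => hw' j (hsd hj)) (by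
                rw [heq]
                exact hwrong k (by omega))
          have hcand' := candidates_eq_of_subset hH' (hcand.trans (hsd.trans hSH))
          have hmem : τ (candidates A H (synth A w) T) ∈ S \ T := hcand (hτ _
            (candidates_nonempty (hne.mono (hsd.trans (hSH.trans hH'))) _ _))
          have hstep : support τ A H (synth A w) T₀ (k + 1) =
            insert (τ (candidates A H (synth A w) T)) T := rfl
          refine ⟨?_, ?_, ?_, ?_⟩
          · rw [hstep, hcand', support, ← heq]
          · exact h0.trans (hstep ▸ Finset.subset_insert _ _)
          · rw [hstep]
            exact Finset.insert_subset (Finset.mem_sdiff.1 hmem).1 h1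
          · rw [hstep, Finset.card_insert_of_notMem (Finset.mem_sdiff.1 hmem).2]
            omega
        · exact absurd h.1 hS
  rcases key K le_rfl with ⟨-, -, h1, h2⟩ | h
  · have : support τ A H (synth A w) T₀ K = S := Finset.eq_of_subset_of_card_le h1 (by omega)
    rw [this]
    exact ⟨subset_rfl, Finset.subset_insert _ _⟩
  · exact h

end Greedy

/-! ### Least squares and the best `K`-term support. -/

section Output

variable {M : ℕ} {ι : Type*} [Fintype ι] {A : Matrix (Fin M) ι ℝ}

lemma isLeastSquares_synth_iff {c : ℝ} {T : Finset ι} (h : LowerBounded A c T) (hc : 0 < c)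
    {w u : ι → ℝ} (hw : ∀ j, j ∉ T → w j = 0) : IsLeastSquares A (synth A w) T u ↔ u = w := by
  constructor
  · rintro ⟨hu, hmin⟩
    have h1 := hmin w hw
    change ‖synth A w - synth A u‖ ≤ ‖synth A w - synth A w‖ at h1
    rw [sub_self, norm_zero, norm_le_zero_iff, sub_eq_zero] at h1
    exact h.eq_of_synth_eq hc hu hw h1.symm
  · rintro rfl
    refine ⟨hw, fun v _ => ?_⟩
    change ‖synth A u - synth A u‖ ≤ _
    simp

lemma norm_sub_restrict_sq (S : Finset ι) (u : ι → ℝ) [DecidableEq ι] :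
    ‖(WithLp.toLp 2 (u - restrict S u) : EuclideanSpace ℝ ι)‖ ^ 2 = ∑ j ∈ Sᶜ, u j ^ 2 := by
  rw [EuclideanSpace.norm_sq_eq, ← Finset.sum_subset (Finset.subset_univ Sᶜ)]
  · refine Finset.sum_congr rfl fun j hj => ?_
    simp [restrict, Finset.mem_compl.1 hj]
  · intro j _ hj
    have : j ∈ S := by simpa using hj
    simp [restrict, this]

/-- Entries outside `H`, such as the dummy coefficient, contribute the same amount for every
admissible set. That amount is attained exactly by the sets catching every nonzero entry in `H`. -/
lemma isBestSupport_iff [DecidableEq ι] {H : Finset ι} {K : ℕ} {u : ι → ℝ} (hKH : K ≤ H.card)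
    (hu : (H.filter fun j => u j ≠ 0).card ≤ K) {That : Finset ι} :
    IsBestSupport H K u That ↔
      That ⊆ H ∧ That.card = K ∧ (H.filter fun j => u j ≠ 0) ⊆ That := by
  have hle : ∀ S ⊆ H, ∑ j ∈ Hᶜ, u j ^ 2 ≤ ∑ j ∈ Sᶜ, u j ^ 2 := fun S hS =>
    Finset.sum_le_sum_of_subset_of_nonneg (Finset.compl_subset_compl.2 hS) fun _ _ _ =>
      sq_nonneg _
  have heq : ∀ S ⊆ H, (H.filter fun j => u j ≠ 0) ⊆ S →
      ∑ j ∈ Sᶜ, u j ^ 2 = ∑ j ∈ Hᶜ, u j ^ 2 := fun S hS hS' => by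
    refine (Finset.sum_subset (Finset.compl_subset_compl.2 hS) fun j hj hj' => ?_).symm
    by_contra h0
    have : u j ≠ 0 := fun h => h0 (by simp [h])
    exact Finset.mem_compl.1 hj (hS' (Finset.mem_filter.2 ⟨by simpa using hj', this⟩))
  have hnorm : ∀ S S' : Finset ι, ‖(WithLp.toLp 2 (u - restrict S u) : EuclideanSpace ℝ ι)‖ ≤
      ‖(WithLp.toLp 2 (u - restrict S' u) : EuclideanSpace ℝ ι)‖ ↔
      ∑ j ∈ Sᶜ, u j ^ 2 ≤ ∑ j ∈ S'ᶜ, u j ^ 2 := fun S S' => by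
    rw [← norm_sub_restrict_sq, ← norm_sub_restrict_sq, sq_le_sq₀ (norm_nonneg _) (norm_nonneg _)]
  refine and_congr_right fun hTH => and_congr_right fun hTK => ⟨fun hmin => ?_, fun hsub => ?_⟩
  · obtain ⟨S, hS, hSH, hSK⟩ := Finset.exists_subsuperset_card_eq
      (Finset.filter_subset (fun j => u j ≠ 0) H) hu hKH
    have h1 := (hnorm _ _).1 (hmin S hSH hSK)
    rw [heq S hSH hS] at h1
    intro j hj
    obtain ⟨hjH, hj0⟩ := Finset.mem_filter.1 hj
    by_contra hjT
    have h2 : ∑ l ∈ insert j Hᶜ, u l ^ 2 ≤ ∑ l ∈ Thatᶜ, u l ^ 2 :=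
      Finset.sum_le_sum_of_subset_of_nonneg (Finset.insert_subset (by simpa using hjT)
        (Finset.compl_subset_compl.2 hTH)) fun _ _ _ => sq_nonneg _
    rw [Finset.sum_insert (by simpa using hjH)] at h2
    have : 0 < u j ^ 2 := by positivity
    linarith
  · intro S hSH _
    rw [hnorm, heq That hTH hsub]
    exact hle S hSH

end Output

/-! ### Specialization to the matrix with the dummy column. -/

section Modified

variable {M N : ℕ}

/-- The indices of the columns of `Φ` that enter `Φ x`, as indices of the augmented matrix. -/
noncomputable def rightIndices (x : Fin N → ℝ) : Finset (Option (Fin N)) :=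
  (Finset.univ.filter fun i => x i ≠ 0).map Function.Embedding.some

/-- The coefficient vector of `Φ x + α d` with respect to the augmented matrix. -/
def augmentVec (α : ℝ) (x : Fin N → ℝ) : Option (Fin N) → ℝ := fun j => j.elim α x

lemma synth_augmentVec (Φ : Matrix (Fin M) (Fin N) ℝ) (d : Fin M → ℝ) (α : ℝ) (x : Fin N → ℝ) :
    synth (augment Φ d) (augmentVec α x) = WithLp.toLp 2 (Φ.mulVec x + α • d) := by
  ext m
  simp [synth, augment, augmentVec, Matrix.mulVec, dotProduct, Fintype.sum_option, mul_comm,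
    add_comm]

lemma some_mem_rightIndices {x : Fin N → ℝ} {i : Fin N} :
    some i ∈ rightIndices x ↔ x i ≠ 0 := by
  simp [rightIndices]

lemma none_notMem_rightIndices (x : Fin N → ℝ) : none ∉ rightIndices x := by
  simp [rightIndices]

lemma card_rightIndices (x : Fin N → ℝ) : (rightIndices x).card = {i | x i ≠ 0}.ncard := by
  rw [rightIndices, Finset.card_map, Set.ncard_eq_toFinset_card']
  congr 1
  ext i
  simp

lemma rightIndices_subset (x : Fin N → ℝ) :
    rightIndices x ⊆ Finset.univ.map Function.Embedding.some :=
  Finset.map_subset_map.2 (Finset.filter_subset _ _)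

lemma augmentVec_eq_zero {α : ℝ} {x : Fin N → ℝ} {j : Option (Fin N)}
    (hj : j ∉ insert none (rightIndices x)) : augmentVec α x j = 0 := by
  cases j with
  | none => simp at hj
  | some i => simpa [augmentVec, some_mem_rightIndices] using hj

lemma isModifiedOutput_iff {τ : Finset (Option (Fin N)) → Option (Fin N)}
    {Φ : Matrix (Fin M) (Fin N) ℝ} {d : Fin M → ℝ} {α : ℝ} {K : ℕ} {x : Fin N → ℝ} (hKN : K ≤ N)
    (hx : {i | x i ≠ 0}.ncard ≤ K) {c : ℝ} (hc : 0 < c)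
    (hsub : insert none (rightIndices x) ⊆ support τ (augment Φ d)
      (Finset.univ.map Function.Embedding.some) (synth (augment Φ d) (augmentVec α x)) {none} K)
    (hlow : LowerBounded (augment Φ d) c (support τ (augment Φ d)
      (Finset.univ.map Function.Embedding.some) (synth (augment Φ d) (augmentVec α x)) {none} K))
    (xhat : Fin N → ℝ) :
    IsModifiedOutput τ Φ d α K (Φ.mulVec x) xhat ↔ xhat = x := by
  have hfilter : ((Finset.univ.map Function.Embedding.some).filter
      fun j => augmentVec α x j ≠ 0) = rightIndices x := by
    ext j
    cases j with
    | none => simp [none_notMem_rightIndices]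
    | some i =>
      rw [Finset.mem_filter, some_mem_rightIndices]
      simp [augmentVec]
  have hbest : ∀ That, IsBestSupport (Finset.univ.map Function.Embedding.some) K
      (augmentVec α x) That ↔ That ⊆ Finset.univ.map Function.Embedding.some ∧ That.card = K ∧
        rightIndices x ⊆ That := fun That => by
    rw [isBestSupport_iff (by simpa using hKN) (by rwa [hfilter, card_rightIndices]), hfilter]
  have hrestrict : ∀ That, rightIndices x ⊆ That →
      (fun i => restrict That (augmentVec α x) (some i)) = x := fun That hThat => by
    funext i
    by_cases hi : x i = 0
    · simp [restrict, Set.indicator_apply, augmentVec, hi]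
    · simp [restrict, augmentVec, hThat (some_mem_rightIndices.2 hi)]
  have hzero : ∀ j, j ∉ support τ (augment Φ d) (Finset.univ.map Function.Embedding.some)
      (synth (augment Φ d) (augmentVec α x)) {none} K → augmentVec α x j = 0 :=
    fun j hj => augmentVec_eq_zero fun hj' => hj (hsub hj')
  unfold IsModifiedOutput IsOutput
  rw [← synth_augmentVec]
  constructor
  · rintro ⟨z, ⟨u, hu, That, hThat, rfl⟩, rfl⟩
    rw [isLeastSquares_synth_iff hlow hc hzero] at hu
    subst hu
    exact hrestrict That ((hbest That).1 hThat).2.2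
  · rintro rfl
    obtain ⟨That, h1, h2, h3⟩ := Finset.exists_subsuperset_card_eq (n := K)
      (rightIndices_subset xhat) (by rwa [card_rightIndices]) (by simpa using hKN)
    exact ⟨restrict That (augmentVec α xhat),
      ⟨augmentVec α xhat, (isLeastSquares_synth_iff hlow hc hzero).2 rfl, That,
        (hbest That).2 ⟨h2, h3, h1⟩, rfl⟩, (hrestrict That h1).symm⟩

/-- The residual after `k` iterations of modified OLS that chooses among the right columns only. -/
noncomputable def oracleResidual (τ : Finset (Option (Fin N)) → Option (Fin N)) (α : ℝ)
    (x : Fin N → ℝ) (k : ℕ) (A : Matrix (Fin M) (Option (Fin N)) ℝ) :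
    EuclideanSpace ℝ (Fin M) :=
  dualProj A (support τ A (rightIndices x) (synth A (augmentVec α x)) {none} k)
    (synth A (augmentVec α x))

/-- Deterministic success criterion for modified OLS. -/
theorem isModifiedOutput_iff_of_oracleResidual {τ : Finset (Option (Fin N)) → Option (Fin N)}
    (hτ : ∀ s : Finset (Option (Fin N)), s.Nonempty → τ s ∈ s)
    {Φ : Matrix (Fin M) (Fin N) ℝ} {d : Fin M → ℝ} {α : ℝ} {K : ℕ} {x : Fin N → ℝ} (hN : 0 < N)
    (hKN : K ≤ N) (hx : {i | x i ≠ 0}.ncard ≤ K) {c L β : ℝ} (hc : 0 < c)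
    (hlow : ∀ i : Fin N,
      LowerBounded (augment Φ d) c (insert (some i) (insert none (rightIndices x))))
    (hL : ∀ j, ‖colVec (augment Φ d) j‖ ^ 2 ≤ L) (hL0 : 0 ≤ L) (hβ : 0 ≤ β)
    (hKβ : K * L * β < c)
    (hwrong : ∀ k < K, ∀ i : Fin N, x i = 0 →
      inner ℝ (colVec (augment Φ d) (some i)) (oracleResidual τ α x k (augment Φ d)) ^ 2 ≤
        β * c * ‖oracleResidual τ α x k (augment Φ d)‖ ^ 2) (xhat : Fin N → ℝ) :
    IsModifiedOutput τ Φ d α K (Φ.mulVec x) xhat ↔ xhat = x := by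
  set H : Finset (Option (Fin N)) := Finset.univ.map Function.Embedding.some with hH
  have hlow' : ∀ i ∈ H, LowerBounded (augment Φ d) c (insert i (insert none (rightIndices x))) :=
    fun i hi => by
      obtain ⟨i, -, rfl⟩ := Finset.mem_map.1 hi
      exact hlow i
  have hsd : insert none (rightIndices x) \ {none} ⊆ rightIndices x := fun j hj => by
    rw [Finset.mem_sdiff, Finset.mem_insert, Finset.mem_singleton] at hj
    exact hj.1.resolve_left hj.2
  obtain ⟨h1, h2⟩ := subset_support (A := augment Φ d) (H := H) (H' := rightIndices x)
    (S := insert none (rightIndices x)) (T₀ := {none}) hτ (K := K) (w := augmentVec α x) hc hlow'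
    (by simp) (rightIndices_subset x) hsd
    (by
      rw [Finset.card_insert_of_notMem (none_notMem_rightIndices x), card_rightIndices]
      simpa using hx)
    (fun j _ => hL j) hL0 hβ hKβ (fun j hj => augmentVec_eq_zero hj)
    (fun j hj => by
      have hj := hsd hj
      cases j with
      | none => exact absurd hj (none_notMem_rightIndices x)
      | some i => exact some_mem_rightIndices.1 hj)
    (fun k hk i hi hiS => by
      obtain ⟨i, -, rfl⟩ := Finset.mem_map.1 hi
      refine hwrong k hk i ?_
      by_contra h0
      exact hiS (Finset.mem_insert_of_mem (some_mem_rightIndices.2 h0)))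
  refine isModifiedOutput_iff hKN hx hc h1 ((hlow' (τ H) ?_).mono h2) xhat
  exact hτ H (by rw [hH, Finset.map_nonempty]; exact ⟨⟨0, hN⟩, Finset.mem_univ _⟩)

end Modified

/-! ### Gaussian and chi-squared tail bounds. -/

section Gaussian

open scoped NNReal

lemma integral_exp_mul_sq_gaussianReal {v : ℝ≥0} (hv : v ≠ 0) {t : ℝ} (ht : 2 * v * t < 1) :
    ∫ x, Real.exp (t * x ^ 2) ∂gaussianReal 0 v = (√(1 - 2 * v * t))⁻¹ := by
  have hv' : (0 : ℝ) < v := by positivity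
  rw [integral_gaussianReal_eq_integral_smul hv]
  have h : ∀ x : ℝ, gaussianPDFReal 0 v x • Real.exp (t * x ^ 2) =
      (√(2 * Real.pi * v))⁻¹ * Real.exp (-((1 - 2 * v * t) / (2 * v)) * x ^ 2) := fun x => by
    rw [gaussianPDFReal, smul_eq_mul, mul_assoc, ← Real.exp_add]
    congr 2
    field_simp
    ring
  simp_rw [h]
  rw [integral_const_mul, integral_gaussian, ← Real.sqrt_inv, ← Real.sqrt_inv,
    ← Real.sqrt_mul (by positivity)]
  congr 1
  have : (0 : ℝ) < 1 - 2 * v * t := by linarith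
  field_simp

variable {Ω : Type*} [MeasurableSpace Ω] {P : Measure Ω} [IsProbabilityMeasure P]

omit [IsProbabilityMeasure P] in
lemma mgf_sq_of_hasLaw_gaussianReal {Z : Ω → ℝ} {v : ℝ≥0} (hZ : HasLaw Z (gaussianReal 0 v) P)
    (hv : v ≠ 0) {t : ℝ} (ht : 2 * v * t < 1) :
    mgf (fun ω => Z ω ^ 2) P t = (√(1 - 2 * v * t))⁻¹ := by
  rw [← integral_exp_mul_sq_gaussianReal hv ht, ← hZ.map_eq,
    integral_map hZ.aemeasurable (by fun_prop)]
  rfl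

omit [IsProbabilityMeasure P] in
lemma mgf_sum_sq_of_hasLaw_gaussianReal {M : ℕ} {Z : Fin M → Ω → ℝ} {v : ℝ≥0}
    (hind : iIndepFun Z P) (hZ : ∀ m, HasLaw (Z m) (gaussianReal 0 v) P) (hv : v ≠ 0) {t : ℝ}
    (ht : 2 * v * t < 1) :
    mgf (fun ω => ∑ m, Z m ω ^ 2) P t = (√(1 - 2 * v * t))⁻¹ ^ M := by
  have h1 : iIndepFun (fun m ω => Z m ω ^ 2) P :=
    hind.comp (fun _ x => x ^ 2) fun _ => by fun_prop
  have h2 := h1.mgf_sum₀ (t := t) (fun m => (hZ m).aemeasurable.pow_const 2) Finset.univ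
  have h3 : (∑ m, fun ω => Z m ω ^ 2) = fun ω => ∑ m, Z m ω ^ 2 := by
    ext ω
    simp
  rw [h3] at h2
  rw [h2]
  simp [fun m => mgf_sq_of_hasLaw_gaussianReal (hZ m) hv ht]

omit [IsProbabilityMeasure P] in
-- The Bochner integral of a non-integrable function is zero by convention.
lemma integrable_exp_of_mgf_ne_zero {X : Ω → ℝ} {t : ℝ} (h : mgf X P t ≠ 0) :
    Integrable (fun ω => Real.exp (t * X ω)) P :=
  not_imp_comm.1 integral_undef h

/-- Lower tail of the chi-squared distribution. -/
lemma measureReal_sum_sq_le {M : ℕ} {Z : Fin M → Ω → ℝ} {v : ℝ≥0} (hind : iIndepFun Z P)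
    (hZ : ∀ m, HasLaw (Z m) (gaussianReal 0 v) P) (hv : v ≠ 0) :
    P.real {ω | ∑ m, Z m ω ^ 2 ≤ M * v / 4} ≤ Real.exp (-(M / 4)) := by
  have hv' : (0 : ℝ) < v := by positivity
  -- Chernoff parameter chosen so that `1 - 2vt = 4` and each factor is `1/2`; `log 2 > 5/8` then
  -- leaves the exponent `3/8 - 5/8 = -1/4`.
  have ht : 2 * v * (-(3 / (2 * v))) < (1 : ℝ) := by
    field_simp
    norm_num
  have hm := mgf_sum_sq_of_hasLaw_gaussianReal hind hZ hv ht
  have h4 : (1 : ℝ) - 2 * v * (-(3 / (2 * v))) = 2 ^ 2 := by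
    field_simp
    norm_num
  rw [h4, Real.sqrt_sq (by norm_num)] at hm
  refine (measure_le_le_exp_mul_mgf _ (by
    rw [neg_nonpos]
    positivity) (integrable_exp_of_mgf_ne_zero (t := -(3 / (2 * (v : ℝ)))) ?_)).trans ?_
  · rw [hm]
    positivity
  · rw [hm, neg_neg]
    have h5 : (2 : ℝ)⁻¹ ≤ Real.exp (-(5 / 8)) := by
      rw [Real.exp_neg]
      gcongr
      rw [← Real.le_log_iff_exp_le (by norm_num)]
      linarith [Real.log_two_gt_d9]
    calc Real.exp (3 / (2 * v) * (M * v / 4)) * (2 : ℝ)⁻¹ ^ M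
        ≤ Real.exp (3 / (2 * v) * (M * v / 4)) * Real.exp (-(5 / 8)) ^ M := by gcongr
      _ = Real.exp (-(M / 4)) := by
        rw [← Real.exp_nat_mul, ← Real.exp_add]
        congr 1
        field_simp
        ring

/-- Upper tail of the chi-squared distribution. -/
lemma measureReal_le_sum_sq {M : ℕ} {Z : Fin M → Ω → ℝ} {v : ℝ≥0} (hind : iIndepFun Z P)
    (hZ : ∀ m, HasLaw (Z m) (gaussianReal 0 v) P) (hv : v ≠ 0) :
    P.real {ω | 4 * (M * v) ≤ ∑ m, Z m ω ^ 2} ≤ Real.exp (-(M / 4)) := by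
  have hv' : (0 : ℝ) < v := by positivity
  -- Here `1 - 2vt = 1/4`, so each factor is `2 ≤ exp (5/4)`, and the exponent is `-3/2 + 5/4 =
  -- -1/4`.
  have ht : 2 * v * (3 / (8 * v)) < (1 : ℝ) := by
    field_simp
    norm_num
  have hm := mgf_sum_sq_of_hasLaw_gaussianReal hind hZ hv ht
  have h4 : (1 : ℝ) - 2 * v * (3 / (8 * v)) = (1 / 2) ^ 2 := by
    field_simp
    norm_num
  rw [h4, Real.sqrt_sq (by norm_num)] at hm
  refine (measure_ge_le_exp_mul_mgf _ (by positivity)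
    (integrable_exp_of_mgf_ne_zero (t := 3 / (8 * (v : ℝ))) ?_)).trans ?_
  · rw [hm]
    positivity
  · rw [hm]
    have h5 : (1 / 2 : ℝ)⁻¹ ≤ Real.exp (5 / 4) := by
      have := Real.add_one_le_exp (5 / 4 : ℝ)
      norm_num
      linarith
    calc Real.exp (-(3 / (8 * v)) * (4 * (M * v))) * (1 / 2 : ℝ)⁻¹ ^ M
        ≤ Real.exp (-(3 / (8 * v)) * (4 * (M * v))) * Real.exp (5 / 4) ^ M := by gcongr
      _ = Real.exp (-(M / 4)) := by
        rw [← Real.exp_nat_mul, ← Real.exp_add]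
        congr 1
        field_simp
        ring

/-- Two-sided tail of a centered Gaussian. -/
lemma measureReal_lt_sq_le {Z : Ω → ℝ} {v : ℝ≥0} (hZ : HasLaw Z (gaussianReal 0 v) P) (hv : v ≠ 0)
    {s : ℝ} (hs : 0 ≤ s) :
    P.real {ω | s * v < Z ω ^ 2} ≤ 2 * Real.exp (-(s / 2)) := by
  have hv' : (0 : ℝ) < v := by positivity
  have hup : ∀ Y : Ω → ℝ, HasLaw Y (gaussianReal 0 v) P →
      P.real {ω | √(s * v) ≤ Y ω} ≤ Real.exp (-(s / 2)) := fun Y hY => by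
    have hm := mgf_gaussianReal hY.map_eq (√(s * v) / v)
    refine (measure_ge_le_exp_mul_mgf (t := √(s * v) / v) _ (by positivity)
      (integrable_exp_of_mgf_ne_zero ?_)).trans ?_
    · rw [hm]
      positivity
    · rw [hm, ← Real.exp_add]
      apply le_of_eq
      congr 1
      have : √(s * v) ^ 2 = s * v := Real.sq_sqrt (by positivity)
      field_simp
      linarith
  have hneg : HasLaw (fun ω => -Z ω) (gaussianReal 0 v) P := by
    have h := gaussianReal_neg hZ
    rwa [neg_zero] at h
  calc P.real {ω | s * v < Z ω ^ 2}
      ≤ P.real ({ω | √(s * v) ≤ Z ω} ∪ {ω | √(s * v) ≤ -Z ω}) := by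
        refine measureReal_mono fun ω hω => ?_
        have h1 : √(s * v) < |Z ω| := by
          rw [← Real.sqrt_sq_eq_abs]
          exact Real.sqrt_lt_sqrt (by positivity) hω
        rcases lt_abs.1 h1 with h | h
        · exact Or.inl h.le
        · exact Or.inr h.le
    _ ≤ P.real {ω | √(s * v) ≤ Z ω} + P.real {ω | √(s * v) ≤ -Z ω} := measureReal_union_le _ _
    _ ≤ _ := by linarith [hup Z hZ, hup _ hneg]

variable {κ : Type*} [Fintype κ]

lemma hasLaw_sum_mul_pi_gaussianReal (v : ℝ≥0) (a : κ → ℝ) :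
    HasLaw (fun W : κ → ℝ => ∑ p, a p * W p) (gaussianReal 0 (v * ∑ p, ‖a p‖₊ ^ 2))
      (Measure.pi fun _ : κ => gaussianReal 0 v) := by
  have hlaw : ∀ p, HasLaw (fun W : κ → ℝ => a p * W p) (gaussianReal 0 (‖a p‖₊ ^ 2 * v))
      (Measure.pi fun _ : κ => gaussianReal 0 v) := fun p => by
    have h := gaussianReal_const_mul (P := Measure.pi fun _ : κ => gaussianReal 0 v)
      (X := fun W => W p) (μ := 0) (v := v)
      ⟨(measurable_pi_apply p).aemeasurable, (measurePreserving_eval _ p).map_eq⟩ (a p)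
    rw [mul_zero] at h
    convert h using 3
    ext
    simp
  have hind : iIndepFun (fun p (W : κ → ℝ) => a p * W p)
      (Measure.pi fun _ : κ => gaussianReal 0 v) :=
    iIndepFun_pi (X := fun p t => a p * t) fun p => by fun_prop
  have hG := iIndepFun.hasGaussianLaw_fun_sum (fun p => (hlaw p).hasGaussianLaw) hind
  refine ⟨hG.aemeasurable, ?_⟩
  rw [hG.map_eq_gaussianReal]
  congr 1
  · rw [integral_finsetSum _ fun p _ => (hlaw p).hasGaussianLaw.integrable]
    refine Finset.sum_eq_zero fun p _ => ?_
    rw [(hlaw p).integral_eq, integral_id_gaussianReal]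
  · have h1 : (fun W : κ → ℝ => ∑ p, a p * W p) = ∑ p, fun W : κ → ℝ => a p * W p := by
      ext W
      simp
    rw [h1, IndepFun.variance_sum fun p _ => (hlaw p).hasGaussianLaw.memLp_two]
    · simp_rw [fun p => (hlaw p).variance_eq, variance_id_gaussianReal]
      rw [← NNReal.coe_sum, Real.toNNReal_coe, ← Finset.sum_mul, mul_comm]
    · exact fun p _ q _ hpq => hind.indepFun hpq

end Gaussian

/-! ### Smallest singular values of Gaussian matrices. -/

section GaussianMatrix

open scoped NNReal

variable {M : ℕ} {ι : Type*} [Fintype ι]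

/-- The law of a matrix with independent entries of law `N(0, 1 / M)`. -/
noncomputable def gaussianMatrix (M : ℕ) (ι : Type*) [Fintype ι] : Measure (Fin M → ι → ℝ) :=
  Measure.pi fun _ => Measure.pi fun _ => gaussianReal 0 (1 / (M : ℝ≥0))

instance : IsProbabilityMeasure (gaussianMatrix M ι) := by
  unfold gaussianMatrix
  infer_instance

lemma norm_synth_sq (A : Fin M → ι → ℝ) (g : ι → ℝ) :
    ‖synth (Matrix.of A) g‖ ^ 2 = ∑ m, (∑ j, g j * A m j) ^ 2 := by
  rw [EuclideanSpace.norm_sq_eq]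
  simp [synth, Matrix.mulVec, dotProduct, mul_comm]

lemma iIndepFun_rows (g : ι → ℝ) :
    iIndepFun (fun m (A : Fin M → ι → ℝ) => ∑ j, g j * A m j) (gaussianMatrix M ι) :=
  iIndepFun_pi (X := fun _ (a : ι → ℝ) => ∑ j, g j * a j) fun _ =>
    (by fun_prop : Measurable _).aemeasurable

lemma hasLaw_row (g : ι → ℝ) (m : Fin M) :
    HasLaw (fun A : Fin M → ι → ℝ => ∑ j, g j * A m j)
      (gaussianReal 0 (1 / (M : ℝ≥0) * ∑ j, ‖g j‖₊ ^ 2)) (gaussianMatrix M ι) :=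
  (hasLaw_sum_mul_pi_gaussianReal (1 / (M : ℝ≥0)) g).comp
    (⟨(measurable_pi_apply m).aemeasurable, (measurePreserving_eval _ m).map_eq⟩ :
      HasLaw (fun A : Fin M → ι → ℝ => A m) _ (gaussianMatrix M ι))

lemma sum_nnnorm_sq_ne_zero {g : ι → ℝ} (hg : g ≠ 0) : ∑ j, ‖g j‖₊ ^ 2 ≠ 0 := by
  obtain ⟨j, hj⟩ := Function.ne_iff.1 hg
  intro h
  rw [Finset.sum_eq_zero_iff] at h
  have := h j (Finset.mem_univ j)
  simp at this
  exact hj this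

lemma measureReal_norm_synth_sq_le (hM : 0 < M) {g : ι → ℝ} (hg : g ≠ 0) :
    (gaussianMatrix M ι).real {A | ‖synth (Matrix.of A) g‖ ^ 2 ≤ (∑ j, g j ^ 2) / 4} ≤
      Real.exp (-(M / 4)) := by
  have h := measureReal_sum_sq_le (iIndepFun_rows (M := M) g) (hasLaw_row g)
    (mul_ne_zero (by positivity) (sum_nnnorm_sq_ne_zero hg))
  convert h using 5
  · exact norm_synth_sq _ _
  · push_cast
    simp only [Real.norm_eq_abs, sq_abs]
    field_simp

lemma measureReal_le_norm_colVec_sq [DecidableEq ι] (hM : 0 < M) (j : ι) :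
    (gaussianMatrix M ι).real {A | 4 ≤ ‖colVec (Matrix.of A) j‖ ^ 2} ≤ Real.exp (-(M / 4)) := by
  have hg : (Pi.single j 1 : ι → ℝ) ≠ 0 := by simp
  have h := measureReal_le_sum_sq (iIndepFun_rows (M := M) (Pi.single j 1 : ι → ℝ)) (hasLaw_row _)
    (mul_ne_zero (by positivity) (sum_nnnorm_sq_ne_zero hg))
  convert h using 5
  · push_cast
    simp only [Real.norm_eq_abs, sq_abs]
    have : ∑ i, (Pi.single j 1 : ι → ℝ) i ^ 2 = 1 := by
      rw [Finset.sum_eq_single j] <;> simp +contextual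
    rw [this]
    field_simp
  · rw [← synth_single, norm_synth_sq]

/-- Integer vectors supported in `U` with entries bounded by `4 |U|`. -/
noncomputable def grid [DecidableEq ι] (U : Finset ι) : Finset (ι → ℤ) :=
  Fintype.piFinset fun j => if j ∈ U then Finset.Icc (-(4 * U.card : ℤ)) (4 * U.card) else {0}

lemma card_grid [DecidableEq ι] (U : Finset ι) : (grid U).card = (8 * U.card + 1) ^ U.card := by
  rw [grid, Fintype.card_piFinset]
  have : ∀ j, (if j ∈ U then Finset.Icc (-(4 * U.card : ℤ)) (4 * U.card) else {0}).card =
      if j ∈ U then 8 * U.card + 1 else 1 := fun j => by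
    split_ifs
    · rw [Int.card_Icc]
      omega
    · simp
  simp_rw [this]
  rw [Finset.prod_ite_mem, Finset.univ_inter, Finset.prod_const]

/-- Scale `v` to norm `4n`, `n = |U|`, and round it to an integer vector `g`. Each coordinate moves
by at most `1/2`, so `‖g‖ ≥ 3n` and the grid hypothesis gives image norm at least `3n/2`. Columns
have norm at most `2`, so rounding moves the image by at most `n`. What remains, `n/2` against `4n`,
is the ratio `1/8`. -/
lemma lowerBounded_of_grid [DecidableEq ι] {A : Matrix (Fin M) ι ℝ} {U : Finset ι}
    (hcol : ∀ j ∈ U, ‖colVec A j‖ ^ 2 ≤ 4)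
    (hgrid : ∀ g ∈ grid U, g ≠ 0 →
      (∑ j, (g j : ℝ) ^ 2) / 4 ≤ ‖synth A fun j => (g j : ℝ)‖ ^ 2) :
    LowerBounded A (1 / 64) U := by
  intro v hv
  set ρ := ‖(WithLp.toLp 2 v : EuclideanSpace ℝ ι)‖ with hρ
  have hρ2 : ρ ^ 2 = ∑ j, v j ^ 2 := by
    rw [hρ, EuclideanSpace.norm_sq_eq]
    simp
  rw [← hρ2]
  rcases (norm_nonneg (WithLp.toLp 2 v : EuclideanSpace ℝ ι)).eq_or_lt with h0 | hpos
  · rw [hρ, ← h0]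
    simp
  replace hpos : 0 < ρ := hpos
  set n : ℝ := (U.card : ℝ) with hn
  set u : ι → ℝ := (4 * n / ρ) • v with hu
  set g : ι → ℤ := fun j => round (u j) with hg
  have huU : ∀ j, j ∉ U → u j = 0 := fun j hj => by simp [hu, hv j hj]
  have hn1 : 1 ≤ n := by
    rw [hn, Nat.one_le_cast, Finset.one_le_card]
    by_contra hU
    rw [Finset.not_nonempty_iff_eq_empty] at hU
    have : v = 0 := funext fun j => hv j (by simp [hU])
    rw [hρ, this] at hpos
    simp at hpos
  have herr : ∀ j, |(g j : ℝ) - u j| ≤ 1 / 2 := fun j => by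
    rw [abs_sub_comm]
    exact abs_sub_round (u j)
  have hgU : ∀ j, j ∉ U → g j = 0 := fun j hj => by simp [hg, huU j hj]
  have hunorm : ‖(WithLp.toLp 2 u : EuclideanSpace ℝ ι)‖ = 4 * n := by
    rw [hu, WithLp.toLp_smul, norm_smul, Real.norm_eq_abs, abs_of_nonneg (by positivity), ← hρ]
    field_simp
  have hgmem : g ∈ grid U := by
    rw [grid, Fintype.mem_piFinset]
    intro j
    split_ifs with hj
    · have h1 : |u j| ≤ 4 * n := by
        rw [← hunorm]
        exact PiLp.norm_apply_le (p := 2) (WithLp.toLp 2 u : EuclideanSpace ℝ ι) j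
      have h2 := abs_le.1 h1
      have h3 := abs_le.1 (herr j)
      rw [Finset.mem_Icc]
      constructor
      · have : (-(4 * U.card : ℤ) : ℝ) - 1 < g j := by push_cast; linarith
        have : (-(4 * U.card : ℤ) - 1 : ℤ) < g j := by exact_mod_cast this
        omega
      · have : (g j : ℝ) < (4 * U.card : ℤ) + 1 := by push_cast; linarith
        have : g j < (4 * U.card : ℤ) + 1 := by exact_mod_cast this
        omega
    · simp [hgU j hj]
  set g' : ι → ℝ := fun j => (g j : ℝ) with hg'
  have hdiff : ‖(WithLp.toLp 2 u : EuclideanSpace ℝ ι) - WithLp.toLp 2 g'‖ ≤ n := by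
    refine abs_le_of_sq_le_sq' ?_ (by linarith) |>.2
    rw [← WithLp.toLp_sub, EuclideanSpace.norm_sq_eq]
    calc ∑ j, ‖(WithLp.toLp 2 (u - g') : EuclideanSpace ℝ ι) j‖ ^ 2
        = ∑ j ∈ U, (g' j - u j) ^ 2 := by
          rw [← Finset.sum_subset (Finset.subset_univ U)]
          · refine Finset.sum_congr rfl fun j _ => ?_
            simp only [Pi.sub_apply, Real.norm_eq_abs, sq_abs]
            ring
          · intro j _ hj
            simp [hg', hgU j hj, huU j hj]
      _ ≤ ∑ j ∈ U, 1 := Finset.sum_le_sum fun j _ => by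
          have := abs_le.1 (herr j)
          nlinarith
      _ = n := by simp [hn]
      _ ≤ n ^ 2 := by nlinarith
  have hgnorm : 3 * n ≤ ‖(WithLp.toLp 2 g' : EuclideanSpace ℝ ι)‖ := by
    have := norm_le_norm_add_norm_sub' (WithLp.toLp 2 u : EuclideanSpace ℝ ι) (WithLp.toLp 2 g')
    linarith
  have hg0 : g ≠ 0 := fun h0 => by
    have : g' = 0 := by
      funext j
      simp [hg', h0]
    rw [this] at hgnorm
    simp at hgnorm
    linarith
  have hsg : 3 / 2 * n ≤ ‖synth A g'‖ := by
    have h1 := hgrid g hgmem hg0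
    have h2 : ∑ j, (g j : ℝ) ^ 2 = ‖(WithLp.toLp 2 g' : EuclideanSpace ℝ ι)‖ ^ 2 := by
      rw [EuclideanSpace.norm_sq_eq]
      simp [hg']
    rw [h2] at h1
    refine abs_le_of_sq_le_sq' ?_ (norm_nonneg _) |>.2
    nlinarith
  have hsd : ‖synth A (g' - u)‖ ≤ n := by
    rw [synth_eq_sum]
    calc ‖∑ j, (g' - u) j • colVec A j‖ = ‖∑ j ∈ U, (g' - u) j • colVec A j‖ := by
          congr 1
          refine (Finset.sum_subset (Finset.subset_univ U) fun j _ hj => ?_).symm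
          simp [hg', hgU j hj, huU j hj]
      _ ≤ ∑ j ∈ U, ‖(g' - u) j • colVec A j‖ := norm_sum_le _ _
      _ ≤ ∑ j ∈ U, 1 := Finset.sum_le_sum fun j hj => by
          rw [norm_smul, Real.norm_eq_abs]
          have h1 : ‖colVec A j‖ ≤ 2 :=
            abs_le_of_sq_le_sq' (by linarith [hcol j hj]) (by norm_num) |>.2
          have h2 : |(g' - u) j| ≤ 1 / 2 := herr j
          nlinarith [norm_nonneg (colVec A j), abs_nonneg ((g' - u) j)]
      _ = n := by simp [hn]
  have hsu : n / 2 ≤ ‖synth A u‖ := by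
    rw [synth_sub] at hsd
    have := norm_le_norm_add_norm_sub' (synth A g') (synth A u)
    linarith
  have hsv : synth A u = (4 * n / ρ) • synth A v := by
    simp [hu, synth, Matrix.mulVec_smul]
  rw [hsv, norm_smul, Real.norm_eq_abs, abs_of_nonneg (by positivity)] at hsu
  have hfin : ρ / 8 ≤ ‖synth A v‖ := by
    have h1 : n / 2 * ρ ≤ 4 * n * ‖synth A v‖ := by
      calc n / 2 * ρ ≤ 4 * n / ρ * ‖synth A v‖ * ρ := by gcongr
        _ = _ := by field_simp
    nlinarith
  nlinarith

lemma measureReal_not_lowerBounded_le [DecidableEq ι] (hM : 0 < M) (U : Finset ι) :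
    (gaussianMatrix M ι).real {A | (∀ j, ‖colVec (Matrix.of A) j‖ ^ 2 ≤ 4) ∧
      ¬ LowerBounded (Matrix.of A) (1 / 64) U} ≤
      (8 * U.card + 1) ^ U.card * Real.exp (-(M / 4)) := by
  let B : (ι → ℤ) → Set (Fin M → ι → ℝ) := fun g =>
    {A | ‖synth (Matrix.of A) fun j => (g j : ℝ)‖ ^ 2 ≤ (∑ j, (g j : ℝ) ^ 2) / 4}
  have hB : ∀ g ∈ (grid U).filter (· ≠ 0),
      (gaussianMatrix M ι).real (B g) ≤ Real.exp (-(M / 4)) := fun g hg => by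
    refine measureReal_norm_synth_sq_le hM fun h0 => ?_
    refine (Finset.mem_filter.1 hg).2 (funext fun j => ?_)
    have := congrFun h0 j
    simpa using this
  calc (gaussianMatrix M ι).real {A | (∀ j, ‖colVec (Matrix.of A) j‖ ^ 2 ≤ 4) ∧
        ¬ LowerBounded (Matrix.of A) (1 / 64) U}
      ≤ (gaussianMatrix M ι).real (⋃ g ∈ (grid U).filter (· ≠ 0), B g) := by
        refine measureReal_mono (fun A hA => ?_) (measure_ne_top _ _)
        by_contra hcon
        simp only [Set.mem_iUnion, not_exists] at hcon
        exact hA.2 (lowerBounded_of_grid (fun j _ => hA.1 j) fun g hg hg0 =>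
          (not_le.1 (hcon g (Finset.mem_filter.2 ⟨hg, hg0⟩))).le)
    _ ≤ ∑ g ∈ (grid U).filter (· ≠ 0), (gaussianMatrix M ι).real (B g) :=
        measureReal_biUnion_finset_le _ B
    _ ≤ ∑ g ∈ (grid U).filter (· ≠ 0), Real.exp (-(M / 4)) := Finset.sum_le_sum hB
    _ ≤ ∑ g ∈ grid U, Real.exp (-(M / 4)) :=
        Finset.sum_le_sum_of_subset_of_nonneg (Finset.filter_subset _ _)
          fun _ _ _ => (Real.exp_pos _).le
    _ = _ := by
        rw [Finset.sum_const, nsmul_eq_mul, card_grid]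
        push_cast
        ring

end GaussianMatrix

/-! ### Measurability of the oracle residual. -/

section Measurability

variable {M : ℕ} {ι : Type*} [Fintype ι]

lemma measurable_apply_of_finite {α β γ : Type*} [MeasurableSpace α] [MeasurableSpace γ]
    [Finite β] {g : α → β} (hg : ∀ b, MeasurableSet {a | g a = b}) {f : β → α → γ}
    (hf : ∀ b, Measurable (f b)) : Measurable fun a => f (g a) a := by
  intro B hB
  have : (fun a => f (g a) a) ⁻¹' B = ⋃ b, {a | g a = b} ∩ f b ⁻¹' B := by
    ext a
    simp
  rw [this]
  exact MeasurableSet.iUnion fun b => (hg b).inter (hf b hB)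

lemma continuous_synth (w : ι → ℝ) :
    Continuous fun A : Fin M → ι → ℝ => synth (Matrix.of A) w := by
  unfold synth
  refine (PiLp.continuous_toLp 2 _).comp (continuous_pi fun m => ?_)
  simp only [Matrix.mulVec, dotProduct, Matrix.of_apply]
  fun_prop

/-- The projection is not continuous in the matrix where the rank drops. The residual norm is
nevertheless an infimum of continuous functions, so its strict sublevel sets are open. -/
lemma measurable_norm_dualProj (T : Finset ι) :
    Measurable fun p : (Fin M → ι → ℝ) × EuclideanSpace ℝ (Fin M) =>
      ‖dualProj (Matrix.of p.1) T p.2‖ := by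
  refine measurable_of_Iio fun c => IsOpen.measurableSet ?_
  have : (fun p : (Fin M → ι → ℝ) × EuclideanSpace ℝ (Fin M) =>
      ‖dualProj (Matrix.of p.1) T p.2‖) ⁻¹' Set.Iio c =
      ⋃ t ∈ {t : ι → ℝ | ∀ j, j ∉ T → t j = 0}, {p | ‖p.2 - synth (Matrix.of p.1) t‖ < c} := by
    ext p
    simp only [Set.mem_preimage, Set.mem_Iio, Set.mem_iUnion, Set.mem_ofPred_eq, exists_prop]
    constructor
    · intro h
      obtain ⟨u, hu, hr⟩ := exists_dualProj_eq_sub (Matrix.of p.1) T p.2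
      obtain ⟨t, ht, rfl⟩ := exists_synth_of_mem_span _ hu
      exact ⟨t, ht, hr ▸ h⟩
    · rintro ⟨t, ht, h⟩
      exact (norm_dualProj_le_norm_sub _ _ (synth_mem_span _ ht)).trans_lt h
  rw [this]
  refine isOpen_biUnion fun t _ => isOpen_lt (Continuous.norm ?_) continuous_const
  exact continuous_snd.sub ((continuous_synth t).comp continuous_fst)

lemma measurable_dualProj (T : Finset ι) :
    Measurable fun p : (Fin M → ι → ℝ) × EuclideanSpace ℝ (Fin M) =>
      dualProj (Matrix.of p.1) T p.2 := by
  have h : ∀ m, Measurable fun p : (Fin M → ι → ℝ) × EuclideanSpace ℝ (Fin M) =>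
      dualProj (Matrix.of p.1) T p.2 m := fun m => by
    -- Polarization recovers each coordinate from residual norms.
    have h1 : ∀ p : (Fin M → ι → ℝ) × EuclideanSpace ℝ (Fin M),
        dualProj (Matrix.of p.1) T p.2 m =
          (‖dualProj (Matrix.of p.1) T (EuclideanSpace.single m 1 + p.2)‖ ^ 2 -
            ‖dualProj (Matrix.of p.1) T (EuclideanSpace.single m 1 - p.2)‖ ^ 2) / 4 := fun p => by
      rw [dualProj_add, dualProj_sub, norm_add_sq_real, norm_sub_sq_real, inner_dualProj_dualProj,
        EuclideanSpace.inner_single_left]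
      simp
      ring
    simp_rw [h1]
    refine Measurable.div_const (Measurable.sub ?_ ?_) _
    · exact ((measurable_norm_dualProj T).comp
        (measurable_fst.prodMk (measurable_const.add measurable_snd))).pow_const 2
    · exact ((measurable_norm_dualProj T).comp
        (measurable_fst.prodMk (measurable_const.sub measurable_snd))).pow_const 2
  have h2 := (WithLp.measurable_toLp 2 (Fin M → ℝ)).comp (measurable_pi_lambda _ h)
  exact h2

lemma measurable_dualProj_synth (T : Finset ι) (w : ι → ℝ) :
    Measurable fun A : Fin M → ι → ℝ => dualProj (Matrix.of A) T (synth (Matrix.of A) w) := by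
  have h : Measurable fun A : Fin M → ι → ℝ => (A, synth (Matrix.of A) w) :=
    measurable_id.prodMk (continuous_synth w).measurable
  have h' := (measurable_dualProj T).comp h
  exact h'

variable [DecidableEq ι]

lemma measurableSet_candidates_eq (H T C : Finset ι) (w : ι → ℝ) :
    MeasurableSet {A : Fin M → ι → ℝ |
      candidates (Matrix.of A) H (synth (Matrix.of A) w) T = C} := by
  have h : ∀ i j, MeasurableSet {A : Fin M → ι → ℝ |
      ‖dualProj (Matrix.of A) (insert i T) (synth (Matrix.of A) w)‖ ^ 2 ≤
        ‖dualProj (Matrix.of A) (insert j T) (synth (Matrix.of A) w)‖ ^ 2} := fun i j =>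
    measurableSet_le ((measurable_dualProj_synth _ w).norm.pow_const 2)
      ((measurable_dualProj_synth _ w).norm.pow_const 2)
  have hmem : ∀ i, MeasurableSet {A : Fin M → ι → ℝ |
      i ∈ candidates (Matrix.of A) H (synth (Matrix.of A) w) T} := fun i => by
    simp only [mem_candidates, Set.ofPred_and, Set.ofPred_forall]
    exact (MeasurableSet.const _).inter
      (MeasurableSet.iInter fun j => MeasurableSet.iInter fun _ => h i j)
  simp only [Finset.ext_iff, Set.ofPred_forall]
  refine MeasurableSet.iInter fun i => ?_
  by_cases hi : i ∈ C
  · simpa [hi] using hmem i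
  · simp only [hi, iff_false]
    exact (hmem i).compl

lemma measurableSet_support_eq (τ : Finset ι → ι) (H T₀ : Finset ι) (w : ι → ℝ) (k : ℕ)
    (T : Finset ι) :
    MeasurableSet {A : Fin M → ι → ℝ |
      support τ (Matrix.of A) H (synth (Matrix.of A) w) T₀ k = T} := by
  induction k generalizing T with
  | zero => exact MeasurableSet.const (T₀ = T)
  | succ k ih =>
    have : {A : Fin M → ι → ℝ |
        support τ (Matrix.of A) H (synth (Matrix.of A) w) T₀ (k + 1) = T} =
        ⋃ T', ⋃ C, {A | support τ (Matrix.of A) H (synth (Matrix.of A) w) T₀ k = T'} ∩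
          ({A | candidates (Matrix.of A) H (synth (Matrix.of A) w) T' = C} ∩
            {_A | insert (τ C) T' = T}) := by
      ext A
      simp [support]
    rw [this]
    exact MeasurableSet.iUnion fun T' => MeasurableSet.iUnion fun C =>
      (ih T').inter ((measurableSet_candidates_eq H T' C w).inter (MeasurableSet.const _))

lemma measurable_oracleResidual {N : ℕ} (τ : Finset (Option (Fin N)) → Option (Fin N)) (α : ℝ)
    (x : Fin N → ℝ) (k : ℕ) :
    Measurable fun A : Fin M → Option (Fin N) → ℝ => oracleResidual τ α x k (Matrix.of A) :=
  measurable_apply_of_finite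
    (f := fun T A => dualProj (Matrix.of A) T (synth (Matrix.of A) (augmentVec α x)))
    (measurableSet_support_eq τ _ _ _ k) fun T => measurable_dualProj_synth T _

end Measurability

/-! ### Dependence of the oracle run on the right and dummy columns only. -/

section Locality

variable {M : ℕ} {ι : Type*} {A B : Matrix (Fin M) ι ℝ}

lemma dualProj_congr {T : Finset ι} (h : ∀ j ∈ T, colVec A j = colVec B j)
    (y : EuclideanSpace ℝ (Fin M)) : dualProj A T y = dualProj B T y := by
  simp only [dualProj, Set.image_congr h]

variable [DecidableEq ι]

lemma candidates_congr {H T : Finset ι} (hT : ∀ j ∈ T, colVec A j = colVec B j)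
    (hH : ∀ j ∈ H, colVec A j = colVec B j) (y : EuclideanSpace ℝ (Fin M)) :
    candidates A H y T = candidates B H y T := by
  have h : ∀ i ∈ H, dualProj A (insert i T) y = dualProj B (insert i T) y := fun i hi =>
    dualProj_congr (fun j hj => (Finset.mem_insert.1 hj).elim (fun h => h ▸ hH i hi) (hT j)) y
  ext i
  rw [mem_candidates, mem_candidates]
  refine and_congr_right fun hi => forall₂_congr fun j hj => ?_
  rw [h i hi, h j hj]

lemma support_congr {τ : Finset ι → ι} (hτ : ∀ s : Finset ι, s.Nonempty → τ s ∈ s)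
    {H T₀ : Finset ι} (hH : H.Nonempty) (hT₀ : ∀ j ∈ T₀, colVec A j = colVec B j)
    (hAB : ∀ j ∈ H, colVec A j = colVec B j) (y : EuclideanSpace ℝ (Fin M)) (k : ℕ) :
    support τ A H y T₀ k = support τ B H y T₀ k ∧
      ∀ j ∈ support τ A H y T₀ k, colVec A j = colVec B j := by
  induction k with
  | zero => exact ⟨rfl, hT₀⟩
  | succ k ih =>
    have hcand := candidates_congr ih.2 hAB y
    refine ⟨?_, fun j hj => ?_⟩
    · rw [support, support, hcand, ih.1]
    · rcases Finset.mem_insert.1 hj with h | h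
      · rw [h]
        exact hAB _ (mem_candidates.1 (hτ _ (candidates_nonempty hH _ _))).1
      · exact ih.2 j h

lemma subset_support_of_start (τ : Finset ι → ι) (H T₀ : Finset ι) (y : EuclideanSpace ℝ (Fin M))
    (k : ℕ) : T₀ ⊆ support τ A H y T₀ k := by
  induction k with
  | zero => exact subset_rfl
  | succ k ih => exact ih.trans (Finset.subset_insert _ _)

omit [DecidableEq ι] in
lemma synth_congr [Fintype ι] {w : ι → ℝ} (h : ∀ j, w j ≠ 0 → colVec A j = colVec B j) :
    synth A w = synth B w := by
  rw [synth_eq_sum, synth_eq_sum]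
  refine Finset.sum_congr rfl fun j _ => ?_
  by_cases hj : w j = 0
  · simp [hj]
  · rw [h j hj]

/-- The oracle residual only depends on the right columns and the dummy column. -/
lemma oracleResidual_congr {N : ℕ} {τ : Finset (Option (Fin N)) → Option (Fin N)}
    (hτ : ∀ s : Finset (Option (Fin N)), s.Nonempty → τ s ∈ s) (α : ℝ) (x : Fin N → ℝ) (k : ℕ)
    {A B : Matrix (Fin M) (Option (Fin N)) ℝ}
    (h : ∀ j ∈ insert none (rightIndices x), colVec A j = colVec B j) :
    oracleResidual τ α x k A = oracleResidual τ α x k B := by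
  rcases (rightIndices x).eq_empty_or_nonempty with hx | hx
  -- For `x = 0` the oracle has no candidates and `τ ∅` is arbitrary, but the residual vanishes
  -- because the measurement is a multiple of the preselected dummy column.
  · have h0 : ∀ A : Matrix (Fin M) (Option (Fin N)) ℝ, oracleResidual τ α x k A = 0 := fun A =>
      dualProj_eq_zero A (synth_mem_span A fun j hj => augmentVec_eq_zero fun hj' =>
        hj (subset_support_of_start _ _ _ _ _ (by simpa [hx] using hj')))
    rw [h0, h0]
  · have hs : synth A (augmentVec α x) = synth B (augmentVec α x) :=
      synth_congr fun j hj => h j (by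
        by_contra hj'
        exact hj (augmentVec_eq_zero hj'))
    have := support_congr hτ (T₀ := {none}) hx (fun j hj => h j (by
        rw [Finset.mem_singleton.1 hj]
        exact Finset.mem_insert_self _ _))
      (fun j hj => h j (Finset.mem_insert_of_mem hj)) (synth B (augmentVec α x)) k
    rw [oracleResidual, oracleResidual, hs, dualProj_congr this.2, this.1]

end Locality

/-! ### Independence of a wrong column and the oracle residual. -/

section Independence

open scoped NNReal

variable {M : ℕ} {ι : Type*} [Fintype ι]

lemma hasLaw_column (i : ι) :
    HasLaw (fun (A : Fin M → ι → ℝ) m => A m i)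
      (Measure.pi fun _ => gaussianReal 0 (1 / (M : ℝ≥0))) (gaussianMatrix M ι) := by
  refine ⟨(measurable_pi_lambda _ fun m => by fun_prop).aemeasurable, ?_⟩
  rw [gaussianMatrix, Measure.pi_map_pi (f := fun _ (a : ι → ℝ) => a i)
    fun m => (measurable_pi_apply i).aemeasurable]
  congr 1
  funext m
  exact (measurePreserving_eval _ i).map_eq

lemma hasLaw_entry (p : Fin M × ι) :
    HasLaw (fun A : Fin M → ι → ℝ => A p.1 p.2) (gaussianReal 0 (1 / (M : ℝ≥0)))
      (gaussianMatrix M ι) :=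
  ⟨(by fun_prop : Measurable _).aemeasurable,
    ((measurePreserving_eval (fun _ : ι => gaussianReal 0 (1 / (M : ℝ≥0))) p.2).comp
      (measurePreserving_eval (fun _ : Fin M =>
        Measure.pi fun _ : ι => gaussianReal 0 (1 / (M : ℝ≥0))) p.1)).map_eq⟩

lemma iIndepFun_entries :
    iIndepFun (fun (p : Fin M × ι) (A : Fin M → ι → ℝ) => A p.1 p.2) (gaussianMatrix M ι) := by
  refine iIndepFun_uncurry' (X := fun m j (A : Fin M → ι → ℝ) => A m j)
    (fun m j => by fun_prop) ?_ fun m => ?_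
  · exact iIndepFun_pi (X := fun _ (a : ι → ℝ) => a) fun _ => aemeasurable_id
  · rw [iIndepFun_iff_map_fun_eq_pi_map fun j => (by fun_prop : Measurable _).aemeasurable]
    simp_rw [fun j => (hasLaw_entry (m, j)).map_eq]
    exact (measurePreserving_eval (fun _ : Fin M =>
      Measure.pi fun _ : ι => gaussianReal 0 (1 / (M : ℝ≥0))) m).map_eq

/-- Replacing column `i` by zero does not change `R`, so `R` is a measurable function of the
remaining entries. -/
lemma indepFun_column_of_congr [DecidableEq ι] {E : Type*} [MeasurableSpace E] (i : ι)
    {R : (Fin M → ι → ℝ) → E} (hR : Measurable R)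
    (hcongr : ∀ A B : Fin M → ι → ℝ, (∀ m, ∀ j ≠ i, A m j = B m j) → R A = R B) :
    IndepFun (fun (A : Fin M → ι → ℝ) m => A m i) R (gaussianMatrix M ι) := by
  let S : Finset (Fin M × ι) := Finset.univ ×ˢ {i}
  let T : Finset (Fin M × ι) := Finset.univ ×ˢ {i}ᶜ
  have hST : Disjoint S T := Finset.disjoint_product.2 (Or.inr disjoint_compl_right)
  have h := iIndepFun_entries.indepFun_finset (μ := gaussianMatrix M ι) S T hST
    fun p => by fun_prop
  let φ : (S → ℝ) → Fin M → ℝ := fun a m => a ⟨(m, i), by simp [S]⟩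
  let ψ : (T → ℝ) → Fin M → ι → ℝ := fun a m j =>
    if hj : j = i then 0 else a ⟨(m, j), by simp [T, hj]⟩
  have hφ : Measurable φ := by fun_prop
  have hψ : Measurable ψ := by
    refine measurable_pi_lambda _ fun m => measurable_pi_lambda _ fun j => ?_
    by_cases hj : j = i
    · simp [ψ, hj]
    · simp only [ψ, hj, dite_false]
      fun_prop
  have hRψ : R = fun A => R (ψ fun p : T => A p.1.1 p.1.2) := funext fun A =>
    hcongr _ _ fun m j hj => by simp [ψ, hj]
  rw [hRψ]
  exact h.comp hφ (hR.comp hψ)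

/-- A Gaussian column has small inner product with a random vector that does not depend on it. -/
lemma measureReal_lt_inner_colVec_sq_le [DecidableEq ι] (hM : 0 < M) (i : ι)
    {R : (Fin M → ι → ℝ) → EuclideanSpace ℝ (Fin M)} (hR : Measurable R)
    (hcongr : ∀ A B : Fin M → ι → ℝ, (∀ m, ∀ j ≠ i, A m j = B m j) → R A = R B) {s : ℝ}
    (hs : 0 ≤ s) :
    (gaussianMatrix M ι).real
      {A | s / M * ‖R A‖ ^ 2 < inner ℝ (colVec (Matrix.of A) i) (R A) ^ 2} ≤
      2 * Real.exp (-(s / 2)) := by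
  have hX := hasLaw_column (M := M) i
  have hXm : Measurable fun (A : Fin M → ι → ℝ) m => A m i := by fun_prop
  have hind := (indepFun_iff_map_prod_eq_prod_map_map hX.aemeasurable hR.aemeasurable).1
    (indepFun_column_of_congr i hR hcongr)
  rw [hX.map_eq] at hind
  let B : Set ((Fin M → ℝ) × EuclideanSpace ℝ (Fin M)) :=
    {p | s / M * ‖p.2‖ ^ 2 < (∑ m, p.2 m * p.1 m) ^ 2}
  have hB : MeasurableSet B := measurableSet_lt (by fun_prop) (by fun_prop)
  -- By independence it suffices to fix the value `r` of `R`: the inner product is then centered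
  -- Gaussian with variance `‖r‖² / M`. For `r = 0` the strict inequality makes the event empty.
  have hsec : ∀ r : EuclideanSpace ℝ (Fin M),
      (Measure.pi fun _ : Fin M => gaussianReal 0 (1 / (M : ℝ≥0))) ((fun a => (a, r)) ⁻¹' B) ≤
        ENNReal.ofReal (2 * Real.exp (-(s / 2))) := fun r => by
    rw [ENNReal.le_ofReal_iff_toReal_le (measure_ne_top _ _) (by positivity)]
    by_cases hr : r = 0
    · simp [B, hr]
      positivity
    · have hr' : (fun m => r m) ≠ 0 := fun h => hr (by
        ext m
        exact congrFun h m)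
      have h := measureReal_lt_sq_le (hasLaw_sum_mul_pi_gaussianReal (1 / (M : ℝ≥0)) fun m => r m)
        (mul_ne_zero (by positivity) (sum_nnnorm_sq_ne_zero hr')) hs
      have hset : (fun a => (a, r)) ⁻¹' B = {a : Fin M → ℝ |
          s * ((1 / (M : ℝ≥0) * ∑ m, ‖r m‖₊ ^ 2 : ℝ≥0) : ℝ) < (∑ m, r m * a m) ^ 2} := by
        ext a
        simp only [B, Set.mem_preimage, Set.mem_ofPred_eq]
        rw [EuclideanSpace.norm_sq_eq]
        push_cast
        rw [← mul_assoc, mul_one_div]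
      rw [hset]
      exact h
  have hset : {A : Fin M → ι → ℝ |
      s / M * ‖R A‖ ^ 2 < inner ℝ (colVec (Matrix.of A) i) (R A) ^ 2} =
      (fun A => ((fun m => A m i), R A)) ⁻¹' B := by
    ext A
    simp [B, colVec, PiLp.inner_apply]
  rw [hset, Measure.real, ← Measure.map_apply (hXm.prodMk hR) hB, hind,
    Measure.prod_apply_symm hB]
  refine ENNReal.toReal_le_of_le_ofReal (by positivity) ((lintegral_mono hsec).trans ?_)
  have := Measure.isProbabilityMeasure_map (μ := gaussianMatrix M ι) hR.aemeasurable
  simp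

end Independence

/-! ### Probability of the good event. -/

section Recovery

open scoped NNReal

variable {M N : ℕ}

/-- The deterministic conditions on the augmented matrix under which modified OLS recovers `x`. -/
structure IsGood (τ : Finset (Option (Fin N)) → Option (Fin N)) (α : ℝ) (x : Fin N → ℝ) (K : ℕ)
    (A : Fin M → Option (Fin N) → ℝ) : Prop where
  colVec_le : ∀ j, ‖colVec (Matrix.of A) j‖ ^ 2 ≤ 4
  lowerBounded : ∀ i : Fin N,
    LowerBounded (Matrix.of A) (1 / 64) (insert (some i) (insert none (rightIndices x)))
  inner_le : ∀ k < K, ∀ i : Fin N, x i = 0 →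
    inner ℝ (colVec (Matrix.of A) (some i)) (oracleResidual τ α x k (Matrix.of A)) ^ 2 ≤
      M / (32768 * K) / M * ‖oracleResidual τ α x k (Matrix.of A)‖ ^ 2

lemma card_insert_insert_rightIndices_le (x : Fin N → ℝ) (i : Fin N) :
    (insert (some i) (insert none (rightIndices x))).card ≤ {i | x i ≠ 0}.ncard + 2 := by
  have h1 := Finset.card_insert_le (some i) (insert none (rightIndices x))
  have h2 := Finset.card_insert_le none (rightIndices x)
  rw [card_rightIndices] at h2
  omega

/-- Union bound over long columns, over failing singular value bounds (one set for each extra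
column), and over correlations for each pair of an iteration and a wrong column. -/
lemma measureReal_not_isGood_le {τ : Finset (Option (Fin N)) → Option (Fin N)}
    (hτ : ∀ s : Finset (Option (Fin N)), s.Nonempty → τ s ∈ s) (α : ℝ) {x : Fin N → ℝ} {K : ℕ}
    (hx : {i | x i ≠ 0}.ncard ≤ K) (hM : 0 < M) :
    (gaussianMatrix M (Option (Fin N))).real {A | ¬ IsGood τ α x K A} ≤
      (N + 1) * Real.exp (-(M / 4)) +
        N * ((8 * (K + 2) + 1) ^ (K + 2) * Real.exp (-(M / 4))) +
        K * N * (2 * Real.exp (-(M / (32768 * K) / 2))) := by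
  let μ := gaussianMatrix M (Option (Fin N))
  let B₁ : Option (Fin N) → Set (Fin M → Option (Fin N) → ℝ) := fun j =>
    {A | 4 ≤ ‖colVec (Matrix.of A) j‖ ^ 2}
  let B₂ : Fin N → Set (Fin M → Option (Fin N) → ℝ) := fun i =>
    {A | (∀ j, ‖colVec (Matrix.of A) j‖ ^ 2 ≤ 4) ∧
      ¬ LowerBounded (Matrix.of A) (1 / 64) (insert (some i) (insert none (rightIndices x)))}
  let B₃ : ℕ × Fin N → Set (Fin M → Option (Fin N) → ℝ) := fun p =>
    {A | x p.2 = 0 ∧ M / (32768 * K) / M * ‖oracleResidual τ α x p.1 (Matrix.of A)‖ ^ 2 <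
      inner ℝ (colVec (Matrix.of A) (some p.2)) (oracleResidual τ α x p.1 (Matrix.of A)) ^ 2}
  have hsub : {A | ¬ IsGood τ α x K A} ⊆ (⋃ j ∈ Finset.univ, B₁ j) ∪ (⋃ i ∈ Finset.univ, B₂ i) ∪
      ⋃ p ∈ Finset.range K ×ˢ Finset.univ, B₃ p := by
    intro A hA
    by_contra hcon
    simp only [Set.mem_union, Set.mem_iUnion, not_or, not_exists] at hcon
    obtain ⟨⟨h1, h2⟩, h3⟩ := hcon
    have hcol : ∀ j, ‖colVec (Matrix.of A) j‖ ^ 2 ≤ 4 := fun j =>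
      (not_le.1 (h1 j (Finset.mem_univ j))).le
    refine hA ⟨hcol, fun i => ?_, fun k hk i hi => ?_⟩
    · by_contra hlow
      exact h2 i (Finset.mem_univ i) ⟨hcol, hlow⟩
    · by_contra hlt
      exact h3 (k, i) (by simpa using hk) ⟨hi, not_le.1 hlt⟩
  have h₁ : μ.real (⋃ j ∈ Finset.univ, B₁ j) ≤ (N + 1) * Real.exp (-(M / 4)) := by
    refine (measureReal_biUnion_finset_le _ B₁).trans ?_
    refine (Finset.sum_le_sum fun j _ => measureReal_le_norm_colVec_sq hM j).trans ?_
    simp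
  have h₂ : μ.real (⋃ i ∈ Finset.univ, B₂ i) ≤
      N * ((8 * (K + 2) + 1) ^ (K + 2) * Real.exp (-(M / 4))) := by
    refine (measureReal_biUnion_finset_le _ B₂).trans ?_
    have hi : ∀ i, μ.real (B₂ i) ≤ (8 * (K + 2) + 1) ^ (K + 2) * Real.exp (-(M / 4)) := fun i => by
      refine (measureReal_not_lowerBounded_le hM _).trans ?_
      have hc := (card_insert_insert_rightIndices_le x i).trans (Nat.add_le_add_right hx 2)
      have hc' : ((insert (some i) (insert none (rightIndices x))).card : ℝ) ≤ K + 2 := by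
        exact_mod_cast hc
      gcongr
      refine (pow_le_pow_left₀ (by positivity) (by linarith) _).trans
        (pow_le_pow_right₀ (by nlinarith [Nat.cast_nonneg (α := ℝ) K]) hc)
    refine (Finset.sum_le_sum fun i _ => hi i).trans ?_
    simp
  have h₃ : μ.real (⋃ p ∈ Finset.range K ×ˢ Finset.univ, B₃ p) ≤
      K * N * (2 * Real.exp (-(M / (32768 * K) / 2))) := by
    refine (measureReal_biUnion_finset_le _ B₃).trans ?_
    have hp : ∀ p, μ.real (B₃ p) ≤ 2 * Real.exp (-(M / (32768 * K) / 2)) := fun p => by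
      by_cases hxp : x p.2 = 0
      · refine le_trans (measureReal_mono fun A hA => hA.2) (measureReal_lt_inner_colVec_sq_le hM
          (some p.2) (measurable_oracleResidual τ α x p.1) (fun A B hAB => ?_) (by positivity))
        refine oracleResidual_congr hτ α x p.1 fun j hj => ?_
        have hj' : j ≠ some p.2 := by
          rintro rfl
          rw [Finset.mem_insert, some_mem_rightIndices] at hj
          simp [hxp] at hj
        ext m
        exact hAB m j hj'
      · have : B₃ p = ∅ := by
          ext A
          simp [B₃, hxp]
        rw [this, measureReal_empty]
        positivity
    refine (Finset.sum_le_sum fun p _ => hp p).trans ?_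
    rw [Finset.sum_const, Finset.card_product, nsmul_eq_mul]
    simp
  calc μ.real {A | ¬ IsGood τ α x K A}
      ≤ μ.real ((⋃ j ∈ Finset.univ, B₁ j) ∪ (⋃ i ∈ Finset.univ, B₂ i) ∪
          ⋃ p ∈ Finset.range K ×ˢ Finset.univ, B₃ p) :=
        measureReal_mono hsub (measure_ne_top _ _)
    _ ≤ μ.real ((⋃ j ∈ Finset.univ, B₁ j) ∪ (⋃ i ∈ Finset.univ, B₂ i)) +
          μ.real (⋃ p ∈ Finset.range K ×ˢ Finset.univ, B₃ p) := measureReal_union_le _ _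
    _ ≤ μ.real (⋃ j ∈ Finset.univ, B₁ j) + μ.real (⋃ i ∈ Finset.univ, B₂ i) +
          μ.real (⋃ p ∈ Finset.range K ×ˢ Finset.univ, B₃ p) := by
        gcongr
        exact measureReal_union_le _ _
    _ ≤ _ := by gcongr

lemma IsGood.isModifiedOutput_iff {τ : Finset (Option (Fin N)) → Option (Fin N)}
    (hτ : ∀ s : Finset (Option (Fin N)), s.Nonempty → τ s ∈ s) {α : ℝ} {x : Fin N → ℝ} {K : ℕ}
    (hK : 1 ≤ K) (hKN : K ≤ N) (hM : 0 < M) (hx : {i | x i ≠ 0}.ncard ≤ K)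
    {Φ : Matrix (Fin M) (Fin N) ℝ} {d : Fin M → ℝ}
    (hgood : IsGood τ α x K fun m j => augment Φ d m j) (xhat : Fin N → ℝ) :
    IsModifiedOutput τ Φ d α K (Φ.mulVec x) xhat ↔ xhat = x := by
  have hK0 : (0 : ℝ) < K := by exact_mod_cast hK
  have hM0 : (0 : ℝ) < M := by exact_mod_cast hM
  -- With these values `K L β = 1/128 < c`, and `β c = 1 / (32768 K)` is the correlation level in
  -- `IsGood`.
  refine isModifiedOutput_iff_of_oracleResidual hτ (c := 1 / 64) (L := 4) (β := 1 / (512 * K))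
    (by omega) hKN hx (by norm_num) hgood.lowerBounded hgood.colVec_le (by norm_num)
    (by positivity) ?_ (fun k hk i hi => ?_) xhat
  · field_simp
    norm_num
  · refine (hgood.inner_le k hk i hi).trans (le_of_eq ?_)
    congr 1
    field_simp
    norm_num

lemma hasLaw_gaussianMatrix {ι Ω : Type*} [Fintype ι] [MeasurableSpace Ω] {P : Measure Ω}
    [IsProbabilityMeasure P] {A : Ω → Fin M → ι → ℝ}
    (hind : iIndepFun (fun (p : Fin M × ι) ω => A ω p.1 p.2) P)
    (hlaw : ∀ p : Fin M × ι, HasLaw (fun ω => A ω p.1 p.2) (gaussianReal 0 (1 / (M : ℝ≥0))) P) :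
    HasLaw A (gaussianMatrix M ι) P := by
  have hA : AEMeasurable A P := aemeasurable_pi_lambda _ fun m => aemeasurable_pi_lambda _ fun j =>
    (hlaw (m, j)).aemeasurable
  have h1 := hind.hasLaw_pi hlaw
  have h2 := (iIndepFun_entries (M := M) (ι := ι)).hasLaw_pi hasLaw_entry
  have hc : Measurable fun (W : Fin M × ι → ℝ) m j => W (m, j) := by fun_prop
  refine ⟨hA, ?_⟩
  have h3 := congrArg (Measure.map fun (W : Fin M × ι → ℝ) m j => W (m, j))
    (h1.map_eq.trans h2.map_eq.symm)
  rw [AEMeasurable.map_map_of_aemeasurable hc.aemeasurable h1.aemeasurable,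
    AEMeasurable.map_map_of_aemeasurable hc.aemeasurable h2.aemeasurable] at h3
  exact h3.trans Measure.map_id

/-- A property of a random object that fails with small outer probability with respect to the law
of the object holds on a measurable event of large probability. -/
lemma exists_measurableSet_of_hasLaw {Ω E : Type*} [MeasurableSpace Ω] [MeasurableSpace E]
    {P : Measure Ω} [IsProbabilityMeasure P] {μ : Measure E} [IsProbabilityMeasure μ] {A : Ω → E}
    (hA : HasLaw A μ P) {p : E → Prop} {δ : ℝ} (hp : μ.real {a | ¬ p a} < δ) :
    ∃ G : Set Ω, MeasurableSet G ∧ 1 - δ < P.real G ∧ ∀ ω ∈ G, p (A ω) := by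
  -- A measurable hull of the failure set has the same measure, so `p` itself need not be
  -- measurable.
  set T := toMeasurable μ {a | ¬ p a} with hT
  have hTm : MeasurableSet T := measurableSet_toMeasurable _ _
  have hnull : NullMeasurableSet (A ⁻¹' Tᶜ) P := hA.aemeasurable.nullMeasurableSet_preimage hTm.compl
  obtain ⟨G, hG, hGm, hGeq⟩ := hnull.exists_measurable_subset_ae_eq
  refine ⟨G, hGm, ?_, fun ω hω => ?_⟩
  · rw [measureReal_congr hGeq, Measure.real,
      ← Measure.map_apply_of_aemeasurable hA.aemeasurable hTm.compl, hA.map_eq, ← Measure.real,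
      probReal_compl_eq_one_sub hTm, Measure.real, hT, measure_toMeasurable]
    have : (μ {a | ¬ p a}).toReal < δ := hp
    linarith
  · by_contra h
    exact hG hω (subset_toMeasurable μ {a | ¬ p a} h)

end Recovery

/-! ### Choice of the constants. -/

section Numerics

lemma two_le_sq_and_le_sq_of_mul_sqrt_lt {N K : ℕ} (hK : 1 ≤ K) (hN : (K : ℝ) * √(K : ℝ) < N) :
    (2 : ℝ) ≤ (N / K : ℝ) ^ 2 ∧ (K : ℝ) ≤ (N / K : ℝ) ^ 2 := by
  have hK0 : (0 : ℝ) < K := by exact_mod_cast hK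
  have h1 : √(K : ℝ) < N / K := by
    rw [lt_div_iff₀ hK0]
    linarith
  have h2 : (K : ℝ) ≤ (N / K : ℝ) ^ 2 := by
    calc (K : ℝ) = √(K : ℝ) ^ 2 := (Real.sq_sqrt hK0.le).symm
      _ ≤ _ := by gcongr
  refine ⟨?_, h2⟩
  rcases hK.eq_or_lt with rfl | hK2
  · have : (1 : ℝ) < N := by simpa using hN
    have h3 : 2 ≤ N := by exact_mod_cast this
    have : (2 : ℝ) ≤ N := by exact_mod_cast h3
    simp
    nlinarith
  · have : (2 : ℝ) ≤ K := by exact_mod_cast hK2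
    linarith

/-- With `q = N / K` and `t = c / q`, the hypothesis on `M` turns the exponentials into powers of
`t`, and `K ≤ q²` turns the prefactors into powers of `q`. Since `t q = c ≤ 1 ≤ q`, a product `q^a
t^b` with `a ≤ b` and `b ≠ 0` is at most `c`. -/
lemma failure_bound_le {M N K : ℕ} (hK : 1 ≤ K) (hN : (K : ℝ) * √(K : ℝ) < N) {c : ℝ} (hc : 0 < c)
    (hc1 : c ≤ 1) (hM : 524288 * K * Real.log (N / (K * c)) ≤ M) :
    (N + 1) * Real.exp (-(M / 4)) + N * ((8 * (K + 2) + 1) ^ (K + 2) * Real.exp (-(M / 4))) +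
      K * N * (2 * Real.exp (-(M / (32768 * K) / 2))) ≤ 5 * c := by
  obtain ⟨hq2, hKq⟩ := two_le_sq_and_le_sq_of_mul_sqrt_lt hK hN
  have hK0 : (0 : ℝ) < K := by exact_mod_cast hK
  have hK1 : (1 : ℝ) ≤ K := by exact_mod_cast hK
  have hN0 : (0 : ℝ) < N := lt_of_le_of_lt (by positivity) hN
  set q : ℝ := N / K with hq
  have hq0 : 0 < q := by positivity
  have hq1 : 1 ≤ q := by nlinarith
  have hNq : (N : ℝ) = K * q := by
    rw [hq]
    field_simp
  set t : ℝ := c / q with ht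
  have ht0 : 0 < t := by positivity
  have ht1 : t ≤ 1 := by
    rw [ht, div_le_one hq0]
    linarith
  have hlog : Real.log (N / (K * c)) = -Real.log t := by
    rw [← Real.log_inv]
    congr 1
    rw [ht, hq]
    field_simp
  rw [hlog] at hM
  have hlogt : Real.log t ≤ 0 := Real.log_nonpos ht0.le ht1
  have hpow : ∀ n : ℕ, t ^ n = Real.exp (n * Real.log t) := fun n => by
    rw [Real.exp_nat_mul, Real.exp_log ht0]
  have e1 : Real.exp (-(M / 4)) ≤ t ^ (100 * K) := by
    rw [hpow, Real.exp_le_exp]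
    push_cast
    nlinarith [mul_nonneg hK0.le (neg_nonneg.2 hlogt)]
  -- The constant `524288 = 8 · 65536` is fixed here; `e1` has ample room.
  have e2 : Real.exp (-(M / (32768 * K) / 2)) ≤ t ^ 8 := by
    rw [hpow, Real.exp_le_exp]
    have : -(8 * Real.log t) ≤ M / (32768 * K) / 2 := by
      rw [div_div, le_div_iff₀ (by positivity)]
      linarith
    push_cast
    linarith
  have hN3 : (N : ℝ) ≤ q ^ 3 := by
    rw [hNq]
    calc (K : ℝ) * q ≤ q ^ 2 * q := by gcongr
      _ = q ^ 3 := by ring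
  have hN1 : (1 : ℝ) ≤ N := by
    rw [hNq]
    nlinarith
  have hcpow : ∀ n : ℕ, n ≠ 0 → c ^ n ≤ c := fun n hn => pow_le_of_le_one hc.le hc1 hn
  have htq : t * q = c := by
    rw [ht]
    field_simp
  have hqt : ∀ a b : ℕ, a ≤ b → b ≠ 0 → q ^ a * t ^ b ≤ c := fun a b hab hb =>
    calc q ^ a * t ^ b ≤ q ^ b * t ^ b := by gcongr
      _ = c ^ b := by rw [← mul_pow, mul_comm, htq]
      _ ≤ c := hcpow b hb
  have T1 : (N + 1) * Real.exp (-(M / 4)) ≤ 2 * c := by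
    calc (N + 1) * Real.exp (-(M / 4)) ≤ (2 * q ^ 3) * t ^ (100 * K) := by
          gcongr
          linarith
      _ = 2 * (q ^ 3 * t ^ (100 * K)) := by ring
      _ ≤ 2 * c := by
          gcongr
          exact hqt _ _ (by omega) (by omega)
  have T2 : N * ((8 * (K + 2) + 1) ^ (K + 2) * Real.exp (-(M / 4))) ≤ c := by
    have h1 : (8 * (K + 2) + 1 : ℝ) ≤ q ^ 12 := by
      have h32 : (2 : ℝ) ^ 5 ≤ (q ^ 2) ^ 5 := by gcongr
      calc (8 * (K + 2) + 1 : ℝ) ≤ 2 ^ 5 * K := by linarith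
        _ ≤ (q ^ 2) ^ 5 * q ^ 2 := by gcongr
        _ = q ^ 12 := by ring
    calc N * ((8 * (K + 2) + 1) ^ (K + 2) * Real.exp (-(M / 4)))
        ≤ q ^ 3 * ((q ^ 12) ^ (K + 2) * t ^ (100 * K)) := by gcongr
      _ = q ^ (3 + 12 * (K + 2)) * t ^ (100 * K) := by
          rw [← pow_mul, ← mul_assoc, ← pow_add]
      _ ≤ c := hqt _ _ (by omega) (by omega)
  have T3 : K * N * (2 * Real.exp (-(M / (32768 * K) / 2))) ≤ 2 * c := by
    calc K * N * (2 * Real.exp (-(M / (32768 * K) / 2))) ≤ q ^ 2 * q ^ 3 * (2 * t ^ 8) := by gcongr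
      _ = 2 * (q ^ 5 * t ^ 8) := by ring
      _ ≤ 2 * c := by
          gcongr
          exact hqt _ _ (by omega) (by omega)
  linarith

/-- Since `N / K ≥ √2`, `log (N / K)` is bounded below by `η = log 2 / 2`, so constants are absorbed
into multiples of it. -/
lemma exists_threshold_le {C c : ℝ} (hC : 0 < C) (hc : 0 < c) :
    ∃ B : ℝ, ∀ N K : ℕ, 1 ≤ K → (K : ℝ) * √(K : ℝ) < N →
      C * K * Real.log (N / (K * c)) + K + 1 ≤ B * (K * Real.log (N / K)) := by
  have hη : 0 < Real.log 2 / 2 := by positivity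
  set η := Real.log 2 / 2 with hηdef
  refine ⟨C + C * |Real.log c| / η + 2 / η, fun N K hK hN => ?_⟩
  obtain ⟨hq2, -⟩ := two_le_sq_and_le_sq_of_mul_sqrt_lt hK hN
  have hK0 : (0 : ℝ) < K := by exact_mod_cast hK
  have hK1 : (1 : ℝ) ≤ K := by exact_mod_cast hK
  have hN0 : (0 : ℝ) < N := lt_of_le_of_lt (by positivity) hN
  have hlog : Real.log (N / (K * c)) = Real.log (N / K) - Real.log c := by
    rw [← div_div, Real.log_div (by positivity) hc.ne']
  have hl : η ≤ Real.log (N / K) := by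
    have := Real.log_le_log (by norm_num) hq2
    rw [Real.log_pow] at this
    push_cast at this
    linarith
  rw [hlog]
  set l := Real.log (N / K)
  have h1 : 1 ≤ l / η := (one_le_div hη).2 hl
  have h2 : -Real.log c ≤ |Real.log c| * (l / η) :=
    (neg_le_abs _).trans (le_mul_of_one_le_right (abs_nonneg _) h1)
  have h3 : C * K * (l - Real.log c) ≤ C * K * (l + |Real.log c| * (l / η)) := by
    gcongr
    linarith
  have h4 : (K : ℝ) + 1 ≤ 2 * K * (l / η) := by nlinarith
  calc C * K * (l - Real.log c) + K + 1
      ≤ C * K * (l + |Real.log c| * (l / η)) + 2 * K * (l / η) := by linarith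
    _ = _ := by ring

end Numerics

end OLS

theorem mainTheorem1 :
    ∃ C : ℝ, 0 < C ∧ ∀ δ : ℝ, 0 < δ → δ < 1 → ∃ c : ℝ, 0 < c ∧
      -- the threshold on the number of measurements is `O(K log (N / K))`
      (∃ B : ℝ, ∀ N K : ℕ, 1 ≤ K → (K : ℝ) * √(K : ℝ) < N →
        C * K * Real.log (N / (K * c)) + K + 1 ≤ B * (K * Real.log (N / K))) ∧
      -- above the threshold, modified OLS recovers `x` with probability exceeding `1 - δ`
      ∀ M N K : ℕ, 1 ≤ K → (K : ℝ) * √(K : ℝ) < N →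
        C * K * Real.log (N / (K * c)) + K + 1 < M →
        ∀ x : Fin N → ℝ, {i | x i ≠ 0}.ncard ≤ K →
        ∀ α : ℝ, ∀ τ : Finset (Option (Fin N)) → Option (Fin N),
        (∀ s : Finset (Option (Fin N)), s.Nonempty → τ s ∈ s) →
        ∀ (Ω : Type*) [MeasurableSpace Ω] (P : Measure Ω) [IsProbabilityMeasure P]
          (Φ : Ω → Matrix (Fin M) (Fin N) ℝ) (d : Ω → Fin M → ℝ),
        -- the entries of `Φ` and of the dummy column are i.i.d. `N(0, 1/M)`
        iIndepFun (fun (p : Fin M × Option (Fin N)) (ω : Ω) =>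
          OLS.augment (Φ ω) (d ω) p.1 p.2) P →
        (∀ p : Fin M × Option (Fin N),
          HasLaw (fun ω => OLS.augment (Φ ω) (d ω) p.1 p.2)
            (gaussianReal 0 (1 / (M : NNReal))) P) →
        ∃ G : Set Ω, MeasurableSet G ∧ 1 - δ < P.real G ∧
          ∀ ω ∈ G, ∀ xhat : Fin N → ℝ,
            OLS.IsModifiedOutput τ (Φ ω) (d ω) α K ((Φ ω).mulVec x) xhat ↔ xhat = x := by
  -- The failure probability is at most `5c`, so `c = δ / 6` makes it strictly less than `δ`.
  refine ⟨524288, by norm_num, fun δ hδ hδ1 => ⟨δ / 6, by positivity,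
    OLS.exists_threshold_le (by norm_num) (by positivity), ?_⟩⟩
  intro M N K hK hN hM x hx α τ hτ Ω _ P _ Φ d hind hlaw
  have hK1 : (1 : ℝ) ≤ K := by exact_mod_cast hK
  have hKN : K ≤ N := by
    have h1 : (1 : ℝ) ≤ √(K : ℝ) := Real.one_le_sqrt.2 hK1
    have h2 : (K : ℝ) ≤ N := by nlinarith
    exact_mod_cast h2
  have hlog : 0 ≤ Real.log (N / (K * (δ / 6))) := by
    refine Real.log_nonneg ((one_le_div (by positivity)).2 ?_)
    have : (K : ℝ) ≤ N := by exact_mod_cast hKN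
    nlinarith
  have hM' : 524288 * K * Real.log (N / (K * (δ / 6))) ≤ M := by linarith
  have hM0 : 0 < M := by
    have h1 : 0 ≤ 524288 * K * Real.log (N / (K * (δ / 6))) := by positivity
    have h2 : (0 : ℝ) < M := by linarith
    exact_mod_cast h2
  obtain ⟨G, hG, hGP, hgood⟩ := OLS.exists_measurableSet_of_hasLaw (p := OLS.IsGood τ α x K)
    (δ := δ) (OLS.hasLaw_gaussianMatrix (A := fun ω m j => OLS.augment (Φ ω) (d ω) m j) hind hlaw)
    (by
      have h1 := OLS.measureReal_not_isGood_le hτ α hx hM0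
      have h2 := OLS.failure_bound_le hK hN (c := δ / 6) (by positivity) (by linarith) hM'
      linarith)
  exact ⟨G, hG, hGP, fun ω hω xhat => (hgood ω hω).isModifiedOutput_iff hτ hK hKN hM0 hx xhat⟩
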